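/- Fix $m\ge 1$, let $\mu_m\subset\mathbb C^*$ be the group of $m$-th roots of unity and $\zeta_m=e^{2\pi i/m}$. Let $\Lambda$ be the ring of symmetric functions over $\mathbb C$, with power sums $p_n$ ($p_\lambda=\prod_i p_{\lambda_i}$), complete homogeneous functions $h_n$ and Schur functions $s_\lambda$. For a formal power series $A=\sum_\alpha c_\alpha t^\alpha$ over $\mathbb C$, plethystic substitution $F\mapsto F(A)$ is the $\mathbb C$-algebra homomorphism from $\Lambda$ to power series with $p_n\mapsto p_n(A):=\sum_\alpha c_\alpha t^{n\alpha}$ for all $n\ge1$ (coefficients are not raised to powers). Put $\Omega(A)=\sum_{n\ge0}h_n(A)$ and, for $Y=y_1+y_2+\cdots$ and $\zeta\in\mathbb C$, $\Omega(Y;\zeta)=\prod_{i\ge1}(1-\zeta y_i)^{-1}$. For $\zeta\in\mu_m$ let $X_\zeta=x_{\zeta,1}+x_{\zeta,2}+\cdots$, and let $R=\bigotimes_{\zeta\in\mu_m}\Lambda(X_\zeta)$. For a function $\rho$ from $\mu_m$ to the set of integer partitions put $$P_\rho=\prod_{\zeta\in\mu_m}p_{\rho(\zeta)}(X_\zeta),\qquad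 Z_\rho=\prod_{\zeta\in\mu_m}z_{\rho(\zeta)}m^{\ell(\rho(\zeta))},\qquad S_\rho=\prod_{1\le j\le m}s_{\rho(\zeta_m^j)}\Big(\frac1m\sum_{\zeta\in\mu_m}\zeta^jX_\zeta\Big),$$ where $z_\lambda=\prod_{r\ge1}m_r(\lambda)!\,r^{m_r(\lambda)}$, $m_r(\lambda)$ is the number of parts of $\lambda$ equal to $r$, and $\ell(\lambda)$ is the number of parts. The $P_\rho$ form a basis of $R$. Let $(-,-)$ be the $\mathbb C$-bilinear pairing on $R$ with $(P_\rho,P_\gamma)=\delta_{\rho,\gamma}Z_\rho$, and put $\overline{\sum_\rho a_\rho P_\rho}=\sum_\rho\overline{a_\rho}P_\rho$. The pairing is extended in its first argument to power series in $Y$ whose coefficients are (possibly infinite) sums of homogeneous elements of $R$ of distinct degrees: the pairing is taken coefficientwise in $Y$ and degree by degree in the variables $x_{\zeta,i}$. Then for every function $\rho$ from $\mu_m$ to the set of partitions, the series $$G_\rho(Y):=\Big(\Omega\Big(\frac1m\sum_{\zeta\in\mu_m}X_\zeta\,\Omega(Y;\zeta)\Big),\ \overline{S_\rho}\Big)$$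 satisfies $$G_\rho(Y)=\prod_{0\le j\le m-1}s_{\rho(\zeta_m^j)}\Big(\sum_{k\ge0}h_{km+j}(Y)\Big).$$ -/

import Mathlib

namespace WreathSym

noncomputable section

open scoped Classical ComplexOrder

/-- The power sum `∑ x_v ^ n` over all variables `v` of colour `i`. -/
def colourPowerSum {σ ι : Type*} (c : σ → ι) (i : ι) (n : ℕ) : MvPowerSeries σ ℂ :=
  fun α => if ∃ v, c v = i ∧ α = Finsupp.single v n then 1 else 0

/-- Products of the `colourPowerSum`s. -/
def colourPowerProd {σ ι : Type*} (c : σ → ι) (s : Multiset (ι × ℕ+)) : MvPowerSeries σ ℂ :=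
  (s.map fun x => colourPowerSum c x.1 x.2).prod

/-- The coloured multiset of nonzero exponents of a monomial. -/
def colourType {σ ι : Type*} (c : σ → ι) (α : σ →₀ ℕ) : Multiset (ι × ℕ+) :=
  α.support.val.map fun v => (c v, (α v).toPNat')

section aux
variable {σ ι : Type*} (c : σ → ι)

lemma coeff_colourPowerSum (i : ι) (n : ℕ) (α : σ →₀ ℕ) :
    MvPowerSeries.coeff α (colourPowerSum c i n) =
      if ∃ v, c v = i ∧ α = Finsupp.single v n then 1 else 0 := rfl

lemma colourType_single_add (v : σ) (n : ℕ+) (β : σ →₀ ℕ) (h : β v = 0) :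
    colourType c (Finsupp.single v (n : ℕ) + β) = (c v, n) ::ₘ colourType c β := by
  have hv : v ∉ β.support := by simpa using h
  have hs : (Finsupp.single v (n : ℕ) + β).support = insert v β.support := by
    ext w
    by_cases hw : w = v
    · subst hw; simp
    · simp [hw]
  unfold colourType
  rw [hs, Finset.insert_val_of_notMem hv, Multiset.map_cons]
  congr 1
  · simp [h]
  · apply Multiset.map_congr rfl
    intro w hw
    have : w ≠ v := by rintro rfl; exact hv hw
    simp [Ne.symm this]

lemma card_colourType (α : σ →₀ ℕ) : (colourType c α).card = α.support.card := by
  simp [colourType]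

lemma colourPowerProd_cons (x : ι × ℕ+) (s : Multiset (ι × ℕ+)) :
    colourPowerProd c (x ::ₘ s) = colourPowerSum c x.1 x.2 * colourPowerProd c s := by
  simp [colourPowerProd]

lemma coeff_colourPowerProd_nonneg (s : Multiset (ι × ℕ+)) (α : σ →₀ ℕ) :
    0 ≤ MvPowerSeries.coeff α (colourPowerProd c s) := by
  induction s using Multiset.induction_on generalizing α with
  | empty =>
    rw [colourPowerProd, Multiset.map_zero, Multiset.prod_zero, MvPowerSeries.coeff_one]
    split_ifs <;> simp
  | cons x s ih =>
    rw [colourPowerProd_cons, MvPowerSeries.coeff_mul]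
    refine Finset.sum_nonneg fun y _ => mul_nonneg ?_ (ih _)
    rw [coeff_colourPowerSum]
    split_ifs <;> simp

lemma colourType_of_coeff_ne_zero (s : Multiset (ι × ℕ+)) (α : σ →₀ ℕ)
    (h : MvPowerSeries.coeff α (colourPowerProd c s) ≠ 0) :
    α.support.card ≤ s.card ∧ (α.support.card = s.card → colourType c α = s) := by
  induction s using Multiset.induction_on generalizing α with
  | empty =>
    rw [colourPowerProd, Multiset.map_zero, Multiset.prod_zero, MvPowerSeries.coeff_one] at h
    have : α = 0 := by by_contra h'; simp [h'] at h
    subst this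
    simp [colourType]
  | cons x s ih =>
    rw [colourPowerProd_cons, MvPowerSeries.coeff_mul] at h
    obtain ⟨⟨a, β⟩, hy, hne⟩ := Finset.exists_ne_zero_of_sum_ne_zero h
    rw [Finset.HasAntidiagonal.mem_antidiagonal] at hy
    dsimp only at hy hne
    have hβ := ih β (right_ne_zero_of_mul hne)
    have ha := left_ne_zero_of_mul hne
    rw [coeff_colourPowerSum] at ha
    obtain ⟨v, hv, rfl⟩ : ∃ v, c v = x.1 ∧ a = Finsupp.single v (x.2 : ℕ) := by
      by_contra h'; simp [h'] at ha
    subst hy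
    have hx : x = (c v, x.2) := by rw [hv]
    by_cases hz : β v = 0
    · have ht := colourType_single_add c v x.2 β hz
      have hc := congrArg Multiset.card ht
      rw [card_colourType, Multiset.card_cons, card_colourType] at hc
      rw [ht, hc, Multiset.card_cons, ← hx]
      refine ⟨by omega, fun h => by rw [hβ.2 (by omega)]⟩
    · have hsub : (Finsupp.single v (x.2 : ℕ) + β).support ⊆ β.support := by
        intro w hw
        by_cases hw' : w = v
        · subst hw'; simpa using hz
        · simpa [Finsupp.single_apply, Ne.symm hw'] using hw
      have := Finset.card_le_card hsub
      rw [Multiset.card_cons]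
      refine ⟨by omega, fun h => by omega⟩

lemma coeff_colourType_ne_zero (α : σ →₀ ℕ) :
    MvPowerSeries.coeff α (colourPowerProd c (colourType c α)) ≠ 0 := by
  induction α using Finsupp.induction with
  | zero => simp [colourType, colourPowerProd]
  | single_add v n β hv hn ih =>
    lift n to ℕ+ using Nat.pos_of_ne_zero hn
    rw [colourType_single_add c v n β (by simpa using hv), colourPowerProd_cons,
      MvPowerSeries.coeff_mul]
    refine (lt_of_lt_of_le (lt_of_le_of_ne (coeff_colourPowerProd_nonneg c _ β) ih.symm) ?_).ne'
    refine le_trans ?_ (Finset.single_le_sum (a := (Finsupp.single v (n : ℕ), β)) ?_ (by simp))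
    · dsimp only
      rw [coeff_colourPowerSum, if_pos ⟨v, rfl, rfl⟩, one_mul]
    · intro y _
      refine mul_nonneg ?_ (coeff_colourPowerProd_nonneg c _ _)
      rw [coeff_colourPowerSum]
      split_ifs <;> simp

lemma exists_colourType (hc : ∀ i, (c ⁻¹' {i}).Infinite) (s : Multiset (ι × ℕ+)) :
    ∃ α, colourType c α = s := by
  induction s using Multiset.induction_on with
  | empty => exact ⟨0, by simp [colourType]⟩
  | cons x s ih =>
    obtain ⟨β, hβ⟩ := ih
    obtain ⟨v, hv, hv'⟩ := (hc x.1).exists_notMem_finset β.support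
    refine ⟨Finsupp.single v (x.2 : ℕ) + β, ?_⟩
    rw [colourType_single_add c v x.2 β (by simpa using hv'), hβ, hv]

lemma coeff_colourPowerProd_eq_zero (s : Multiset (ι × ℕ+)) (α : σ →₀ ℕ)
    (h : s.card ≤ α.support.card) (h' : colourType c α ≠ s) :
    MvPowerSeries.coeff α (colourPowerProd c s) = 0 := by
  by_contra hne
  have := colourType_of_coeff_ne_zero c s α hne
  exact h' (this.2 (by omega))

lemma linearIndependent_colourPowerProd (hc : ∀ i, (c ⁻¹' {i}).Infinite) :
    LinearIndependent ℂ (colourPowerProd c) := by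
  rw [linearIndependent_iff']
  intro S g hg
  by_contra! hcon
  obtain ⟨t, htS, ht⟩ := hcon
  obtain ⟨s, hs, hmax⟩ := Finset.exists_max_image (S.filter fun s => g s ≠ 0) Multiset.card
    ⟨t, by simp [htS, ht]⟩
  rw [Finset.mem_filter] at hs
  obtain ⟨α, hα⟩ := exists_colourType c hc s
  have h := congrArg (MvPowerSeries.coeff α) hg
  rw [map_sum, map_zero, Finset.sum_eq_single s] at h
  · rw [map_smul, smul_eq_mul, ← hα] at h
    rcases mul_eq_zero.1 h with h | h
    · exact hs.2 (hα ▸ h)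
    · exact coeff_colourType_ne_zero c α h
  · intro u hu hus
    rw [map_smul, smul_eq_mul]
    by_cases hgu : g u = 0
    · rw [hgu, zero_mul]
    · rw [coeff_colourPowerProd_eq_zero, mul_zero]
      · rw [← card_colourType c, hα]
        exact hmax u (by simp [hu, hgu])
      · rw [hα]; exact hus.symm
  · intro h; exact absurd hs.1 h

lemma aeval_monomial_colourPowerSum (d : ι × ℕ+ →₀ ℕ) :
    MvPolynomial.aeval (fun x : ι × ℕ+ => colourPowerSum c x.1 x.2)
      (MvPolynomial.monomial d (1 : ℂ)) = colourPowerProd c (Finsupp.toMultiset d) := by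
  rw [MvPolynomial.aeval_monomial, map_one, one_mul, colourPowerProd,
    Finsupp.toMultiset_map, Finsupp.prod_toMultiset, Finsupp.prod_mapDomain_index (by simp)
      (fun _ _ _ => pow_add _ _ _)]

lemma exists_perm_of_colourType_eq (α β : ℕ →₀ ℕ)
    (h : colourType (fun _ : ℕ => ()) α = colourType (fun _ : ℕ => ()) β) :
    ∃ e : Equiv.Perm ℕ, Finsupp.mapDomain e α = β := by
  induction α using Finsupp.induction generalizing β with
  | zero =>
    refine ⟨1, ?_⟩
    have := congrArg Multiset.card h
    rw [card_colourType, card_colourType] at this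
    rw [Finsupp.support_zero, Finset.card_empty, eq_comm, Finset.card_eq_zero,
      Finsupp.support_eq_empty] at this
    simp [this]
  | single_add v n α hv hn ih =>
    lift n to ℕ+ using Nat.pos_of_ne_zero hn
    rw [colourType_single_add _ v n α (by simpa using hv)] at h
    have hmem : ((), n) ∈ colourType (fun _ : ℕ => ()) β := h ▸ Multiset.mem_cons_self _ _
    obtain ⟨w, hw, hwn⟩ := Multiset.mem_map.1 hmem
    have hwn' : β w = n := by
      have h1 : (β w).toPNat' = n := (Prod.ext_iff.1 hwn).2
      have h2 : β w ≠ 0 := by simpa using hw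
      rw [← h1, Nat.toPNat'_coe, if_pos (Nat.pos_of_ne_zero h2)]
    have hβ : Finsupp.single w (n : ℕ) + β.erase w = β := by
      rw [← hwn']; exact Finsupp.single_add_erase w β
    rw [← hβ, colourType_single_add _ w n _ (by simp), Multiset.cons_inj_right] at h
    obtain ⟨e, he⟩ := ih _ h
    refine ⟨e.trans (Equiv.swap (e v) w), ?_⟩
    rw [Finsupp.mapDomain_add, ← hβ, Finsupp.mapDomain_single]
    congr 1
    · simp
    · rw [← he]
      refine Finsupp.mapDomain_congr fun u hu => ?_
      have h1 : e u ≠ e v := fun h => by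
        have := e.injective h
        subst this; exact hv hu
      have h2 : e u ≠ w := fun h => by
        have h3 : (Finsupp.mapDomain e α) (e u) = α u := Finsupp.mapDomain_apply e.injective _ _
        rw [he, h, Finsupp.erase_same] at h3
        exact (Finsupp.mem_support_iff.1 hu) h3.symm
      simp [Equiv.swap_apply_of_ne_of_ne h1 h2]

end aux

/-! ### Symmetric functions -/

/-- A partition: a finite multiset of positive integers. -/
abbrev Par : Type := Multiset ℕ+

/-- `z_λ = ∏_r m_r(λ)! r ^ m_r(λ)`. -/
def zPar (lam : Par) : ℕ :=
  ∏ r ∈ lam.toFinset, (lam.count r).factorial * (r : ℕ) ^ lam.count r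

/-- The ring `Λ` of symmetric functions over `ℂ` in the variables `x_0, x_1, …`: the power series
of bounded degree that are invariant under all permutations of the variables. -/
def Lam : Subalgebra ℂ (MvPowerSeries ℕ ℂ) where
  carrier := {f | (∀ e : Equiv.Perm ℕ, MvPowerSeries.rename e f = f) ∧
    ∃ d : ℕ, ∀ α : ℕ →₀ ℕ, d < α.degree → MvPowerSeries.coeff α f = 0}
  mul_mem' := by
    rintro f g ⟨hf, df, hdf⟩ ⟨hg, dg, hdg⟩
    refine ⟨fun e => by rw [map_mul, hf, hg], df + dg, fun α hα => ?_⟩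
    rw [MvPowerSeries.coeff_mul]
    refine Finset.sum_eq_zero fun x hx => ?_
    rw [Finset.HasAntidiagonal.mem_antidiagonal] at hx
    have h : x.1.degree + x.2.degree = α.degree := by rw [← hx, map_add]
    by_cases h1 : df < x.1.degree
    · rw [hdf _ h1, zero_mul]
    · rw [hdg _ (by omega), mul_zero]
  add_mem' := by
    rintro f g ⟨hf, df, hdf⟩ ⟨hg, dg, hdg⟩
    refine ⟨fun e => by rw [map_add, hf, hg], df + dg, fun α hα => ?_⟩
    rw [map_add, hdf _ (by omega), hdg _ (by omega), add_zero]
  algebraMap_mem' r := by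
    refine ⟨fun e => AlgHom.commutes _ r, 0, fun α hα => ?_⟩
    have : α ≠ 0 := by rintro rfl; simp at hα
    rw [MvPowerSeries.algebraMap_apply, Algebra.algebraMap_self, RingHom.id_apply,
      MvPowerSeries.coeff_C, if_neg this]

lemma coeff_mapDomain_rename (e : Equiv.Perm ℕ) (f : MvPowerSeries ℕ ℂ) (α : ℕ →₀ ℕ) :
    MvPowerSeries.coeff (Finsupp.mapDomain e α) (MvPowerSeries.rename e f) =
      MvPowerSeries.coeff α f := by
  have := MvPowerSeries.coeff_embDomain_rename e.toEmbedding f α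
  rw [Finsupp.embDomain_eq_mapDomain] at this
  exact this

/-- Invariance under permutations of the variables, on the level of coefficients. -/
lemma mem_Lam_of_coeff (f : MvPowerSeries ℕ ℂ)
    (h : ∀ (e : Equiv.Perm ℕ) (α : ℕ →₀ ℕ),
      MvPowerSeries.coeff (Finsupp.mapDomain e α) f = MvPowerSeries.coeff α f)
    (hd : ∃ d : ℕ, ∀ α : ℕ →₀ ℕ, d < α.degree → MvPowerSeries.coeff α f = 0) : f ∈ Lam := by
  refine ⟨fun e => ?_, hd⟩
  ext β
  obtain ⟨α, rfl⟩ : ∃ α, Finsupp.mapDomain e α = β :=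
    ⟨Finsupp.mapDomain e.symm β, by rw [← Finsupp.mapDomain_comp]; simp⟩
  rw [coeff_mapDomain_rename, h]

/-- The complete homogeneous series `h_n`, the sum of all monomials of degree `n`. -/
def hSeries (n : ℕ) : MvPowerSeries ℕ ℂ := fun α => if α.degree = n then 1 else 0

/-- The power sum series `p_n = ∑_i x_i ^ n`. -/
def pSeries (n : ℕ+) : MvPowerSeries ℕ ℂ :=
  fun α => if ∃ i, α = Finsupp.single i (n : ℕ) then 1 else 0

lemma degree_mapDomain_perm (e : Equiv.Perm ℕ) (α : ℕ →₀ ℕ) :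
    (Finsupp.mapDomain e α).degree = α.degree := by
  simp [Finsupp.degree_mapDomain]

lemma hSeries_mem (n : ℕ) : hSeries n ∈ Lam := by
  refine mem_Lam_of_coeff _ (fun e α => ?_) ⟨n, fun α hα => if_neg (by omega)⟩
  change (if (Finsupp.mapDomain e α).degree = n then (1 : ℂ) else 0) = if α.degree = n then 1 else 0
  rw [degree_mapDomain_perm]

lemma pSeries_mem (n : ℕ+) : pSeries n ∈ Lam := by
  refine mem_Lam_of_coeff _ (fun e α => ?_) ⟨n, fun α hα => if_neg ?_⟩
  · change (if ∃ i, Finsupp.mapDomain e α = Finsupp.single i (n : ℕ) then (1 : ℂ) else 0) =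
      if ∃ i, α = Finsupp.single i (n : ℕ) then 1 else 0
    refine if_congr ⟨?_, ?_⟩ rfl rfl
    · rintro ⟨i, hi⟩
      refine ⟨e.symm i, Finsupp.mapDomain_injective e.injective ?_⟩
      rw [hi, Finsupp.mapDomain_single, Equiv.apply_symm_apply]
    · rintro ⟨i, rfl⟩
      exact ⟨e i, Finsupp.mapDomain_single⟩
  · rintro ⟨i, rfl⟩
    simp at hα

/-- `h_n` as an element of `Λ`. -/
def h (n : ℕ) : Lam := ⟨hSeries n, hSeries_mem n⟩

/-- `p_n` as an element of `Λ`, for `n ≥ 1`. -/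
def p (n : ℕ+) : Lam := ⟨pSeries n, pSeries_mem n⟩

/-- `p_λ = ∏ p_{λ_i}`. -/
def pPar (lam : Par) : Lam := (lam.map p).prod

/-- `h_k` for an integer `k`, with `h_k = 0` for `k < 0`. -/
def hInt : ℤ → Lam
  | Int.ofNat n => h n
  | Int.negSucc _ => 0

/-- The parts of a partition in weakly decreasing order. -/
def parts (lam : Par) : List ℕ+ := lam.sort (· ≥ ·)

/-- The Schur function `s_λ = det (h_{λ_i - i + j})_{1 ≤ i, j ≤ ℓ(λ)}`. -/
def schur (lam : Par) : Lam :=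
  Matrix.det (Matrix.of fun i j : Fin (parts lam).length =>
    hInt ((((parts lam).get i : ℕ+) : ℕ) - (i : ℕ) + (j : ℕ) : ℤ))

lemma colourPowerSum_unit (x : Unit × ℕ+) :
    colourPowerSum (fun _ : ℕ => ()) x.1 x.2 = pSeries x.2 := by
  funext α
  simp [colourPowerSum, pSeries]

lemma mem_adjoin_pSeries (r : ℕ) (f : MvPowerSeries ℕ ℂ) (hf : f ∈ Lam)
    (hr : ∀ α : ℕ →₀ ℕ, r ≤ α.support.card → MvPowerSeries.coeff α f = 0) :
    f ∈ Algebra.adjoin ℂ (Set.range pSeries) := by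
  induction r generalizing f with
  | zero =>
    have : f = 0 := by ext α; simp [hr α (Nat.zero_le _)]
    rw [this]; exact zero_mem _
  | succ r ih =>
    let c : ℕ → Unit := fun _ => ()
    have hmem : ∀ s, colourPowerProd c s ∈ Algebra.adjoin ℂ (Set.range pSeries) := by
      intro s
      refine Subalgebra.multiset_prod_mem _ fun y hy => ?_
      obtain ⟨x, -, rfl⟩ := Multiset.mem_map.1 hy
      exact Algebra.subset_adjoin ⟨x.2, (colourPowerSum_unit x).symm⟩
    have hle : Algebra.adjoin ℂ (Set.range pSeries) ≤ Lam :=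
      Algebra.adjoin_le (by rintro _ ⟨n, rfl⟩; exact pSeries_mem n)
    choose a ha using exists_colourType c fun i => by
      have : c ⁻¹' {i} = Set.univ := by ext; simp
      rw [this]; exact Set.infinite_univ
    have hcoeff : ∀ g ∈ Lam, ∀ α, MvPowerSeries.coeff α g =
        MvPowerSeries.coeff (a (colourType c α)) g := by
      intro g hg α
      obtain ⟨e, he⟩ := exists_perm_of_colourType_eq _ _ (ha (colourType c α)).symm
      rw [← he]
      conv_rhs => rw [← hg.1 e]
      rw [coeff_mapDomain_rename]
    obtain ⟨d, hd⟩ := hf.2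
    have hfin : {s : Multiset (Unit × ℕ+) | s.card = r ∧
        MvPowerSeries.coeff (a s) f ≠ 0}.Finite := by
      let T : Finset (Unit × ℕ+) := Finset.univ ×ˢ Finset.Icc 1 d.succPNat
      refine (Set.finite_Iic (r • T.val)).subset ?_
      rintro s ⟨hs, hne⟩
      refine Multiset.le_iff_count.2 fun x => ?_
      by_cases hx : x ∈ s
      · have hxT : x ∈ T := by
          have hx' := hx
          rw [← ha s] at hx'
          obtain ⟨v, hv, rfl⟩ := Multiset.mem_map.1 hx'
          have h1 : (a s).degree ≤ d := by
            by_contra hlt; exact hne (hd _ (by omega))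
          have h2 : a s v ≤ (a s).degree := Finsupp.le_degree v (a s)
          have h3 : a s v ≠ 0 := Finsupp.mem_support_iff.1 hv
          simp only [T, Finset.mem_product, Finset.mem_univ, true_and, Finset.mem_Icc,
            one_le]
          rw [← PNat.coe_le_coe, Nat.toPNat'_coe, if_pos (Nat.pos_of_ne_zero h3),
            Nat.succPNat_coe]
          omega
        rw [Multiset.count_nsmul, Multiset.count_eq_one_of_mem T.nodup hxT, mul_one, ← hs]
        exact Multiset.count_le_card x s
      · rw [Multiset.count_eq_zero_of_notMem hx]; exact Nat.zero_le _
    let g := ∑ s ∈ hfin.toFinset, (MvPowerSeries.coeff (a s) f /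
      MvPowerSeries.coeff (a s) (colourPowerProd c s)) • colourPowerProd c s
    have hg : g ∈ Algebra.adjoin ℂ (Set.range pSeries) :=
      Subalgebra.sum_mem _ fun s _ => Subalgebra.smul_mem _ (hmem s) _
    have hfg : f - g ∈ Lam := sub_mem hf (hle hg)
    have key : f - g ∈ Algebra.adjoin ℂ (Set.range pSeries) := by
      refine ih _ hfg fun α hα => ?_
      rw [hcoeff _ hfg]
      set t := colourType c α with ht
      have hcard : (a t).support.card = α.support.card := by
        rw [← card_colourType c, ha, ht, card_colourType]
      rw [map_sub, sub_eq_zero]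
      simp only [g, map_sum, map_smul, smul_eq_mul]
      have hz : ∀ s ∈ hfin.toFinset, s ≠ t → MvPowerSeries.coeff (a s) f /
          MvPowerSeries.coeff (a s) (colourPowerProd c s) *
          MvPowerSeries.coeff (a t) (colourPowerProd c s) = 0 := by
        intro s hs hst
        have hs' := (hfin.mem_toFinset.1 hs).1
        rw [coeff_colourPowerProd_eq_zero c s (a t) (by omega) (by rw [ha]; exact hst.symm),
          mul_zero]
      by_cases htm : t ∈ hfin.toFinset
      · rw [Finset.sum_eq_single_of_mem t htm hz, div_mul_cancel₀]
        have := coeff_colourType_ne_zero c (a t)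
        rwa [ha] at this
      · rw [Finset.sum_eq_zero fun s hs => hz s hs (by rintro rfl; exact htm hs)]
        by_contra hne
        rcases hα.eq_or_lt with h1 | h1
        · refine htm (hfin.mem_toFinset.2 ⟨?_, hne⟩)
          rw [ht, card_colourType, h1]
        · exact hne (hr _ (by omega))
    simpa using add_mem key hg

lemma pSeries_eq_colourPowerSum (n : ℕ+) :
    pSeries n = colourPowerSum (fun _ : ℕ => ()) () n := (colourPowerSum_unit ((), n)).symm

lemma aeval_p_injective : Function.Injective (MvPolynomial.aeval (R := ℂ) pSeries) := by
  have hli := linearIndependent_colourPowerProd (fun _ : ℕ => ()) (fun i => by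
    have : (fun _ : ℕ => ()) ⁻¹' {i} = Set.univ := by ext; simp
    rw [this]; exact Set.infinite_univ)
  have hli' : LinearIndependent ℂ fun d : ℕ+ →₀ ℕ =>
      colourPowerProd (fun _ : ℕ => ()) ((Finsupp.toMultiset d).map fun n => ((), n)) := by
    refine hli.comp _ fun d d' hd => ?_
    exact Multiset.toFinsupp.symm.injective
      (Multiset.map_injective (fun x y hxy => (Prod.ext_iff.1 hxy).2) hd)
  have hmon : ∀ d : ℕ+ →₀ ℕ, (MvPolynomial.aeval (R := ℂ) pSeries).toLinearMap
      (MvPolynomial.basisMonomials ℕ+ ℂ d) =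
      colourPowerProd (fun _ : ℕ => ()) ((Finsupp.toMultiset d).map fun n => ((), n)) := by
    intro d
    rw [AlgHom.toLinearMap_apply, MvPolynomial.coe_basisMonomials, MvPolynomial.aeval_monomial,
      map_one, one_mul, colourPowerProd, Multiset.map_map, Finsupp.toMultiset_map,
      Finsupp.prod_toMultiset, Finsupp.prod_mapDomain_index (by simp) (fun _ _ _ => pow_add _ _ _)]
    simp only [pSeries_eq_colourPowerSum, Function.comp_apply]
  have := LinearMap.injective_of_linearIndependent
    (f := (MvPolynomial.aeval (R := ℂ) pSeries).toLinearMap)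
    (MvPolynomial.basisMonomials ℕ+ ℂ).span_eq (by simpa only [Function.comp_def, hmon] using hli')
  exact this

lemma aeval_p_bijective :
    Function.Bijective (MvPolynomial.aeval p : MvPolynomial ℕ+ ℂ →ₐ[ℂ] Lam) := by
  have hcomp : ∀ q : MvPolynomial ℕ+ ℂ, ((MvPolynomial.aeval p q : Lam) : MvPowerSeries ℕ ℂ) =
      MvPolynomial.aeval pSeries q := by
    intro q
    have : Lam.val.comp (MvPolynomial.aeval p) = MvPolynomial.aeval (R := ℂ) pSeries := by
      ext1 n; simp [p]
    exact DFunLike.congr_fun this q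
  refine ⟨fun q q' hq => aeval_p_injective ?_, fun f => ?_⟩
  · rw [← hcomp, ← hcomp, hq]
  · obtain ⟨d, hd⟩ := f.2.2
    have hf := mem_adjoin_pSeries (d + 1) f.1 f.2 fun α hα => hd α (by
      have : α.support.card ≤ α.degree := by
        rw [Finsupp.degree_apply, Finset.card_eq_sum_ones]
        exact Finset.sum_le_sum fun i hi => Nat.one_le_iff_ne_zero.2 (Finsupp.mem_support_iff.1 hi)
      omega)
    rw [Algebra.adjoin_range_eq_range_aeval] at hf
    obtain ⟨q, hq⟩ := hf
    exact ⟨q, Subtype.ext ((hcomp q).trans hq)⟩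

/-- `Λ` is the polynomial ring over `ℂ` in the power sums `p_1, p_2, …`. -/
def powerSumEquiv : MvPolynomial ℕ+ ℂ ≃ₐ[ℂ] Lam :=
  AlgEquiv.ofBijective (MvPolynomial.aeval p) aeval_p_bijective

/-- Plethystic substitution `F ↦ F(A)`: the `ℂ`-algebra homomorphism on `Λ` that sends `p_n` to
`p_n(A) = ∑ c_α t^{nα}`, where `A = ∑ c_α t^α`. -/
def pleth {τ : Type*} (A : MvPowerSeries τ ℂ) : Lam →ₐ[ℂ] MvPowerSeries τ ℂ :=
  (MvPolynomial.aeval fun n : ℕ+ => MvPowerSeries.expand (n : ℕ) n.ne_zero A).comp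
    (powerSumEquiv.symm : Lam →ₐ[ℂ] MvPolynomial ℕ+ ℂ)

lemma pleth_p {τ : Type*} (A : MvPowerSeries τ ℂ) (n : ℕ+) :
    pleth A (p n) = MvPowerSeries.expand (n : ℕ) n.ne_zero A := by
  have : powerSumEquiv.symm (p n) = MvPolynomial.X n := by
    rw [AlgEquiv.symm_apply_eq]
    simp [powerSumEquiv]
  simp [pleth, this]

/-- Two algebra homomorphisms on `Λ` that agree on the power sums are equal. -/
lemma Lam_algHom_ext {B : Type*} [Semiring B] [Algebra ℂ B] {φ ψ : Lam →ₐ[ℂ] B}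
    (H : ∀ n, φ (p n) = ψ (p n)) : φ = ψ := by
  have : φ.comp (powerSumEquiv : MvPolynomial ℕ+ ℂ →ₐ[ℂ] Lam) =
      ψ.comp (powerSumEquiv : MvPolynomial ℕ+ ℂ →ₐ[ℂ] Lam) := by
    ext1 n
    simpa [powerSumEquiv] using H n
  ext1 f
  obtain ⟨q, rfl⟩ := powerSumEquiv.surjective f
  exact DFunLike.congr_fun this q

lemma pleth_mem {τ : Type*} (A : MvPowerSeries τ ℂ) (B : Subalgebra ℂ (MvPowerSeries τ ℂ))
    (hB : ∀ n : ℕ+, MvPowerSeries.expand (n : ℕ) n.ne_zero A ∈ B) (f : Lam) : pleth A f ∈ B := by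
  have hle : Algebra.adjoin ℂ (Set.range fun n : ℕ+ =>
      MvPowerSeries.expand (n : ℕ) n.ne_zero A) ≤ B :=
    Algebra.adjoin_le (by rintro _ ⟨n, rfl⟩; exact hB n)
  apply hle
  rw [Algebra.adjoin_range_eq_range_aeval]
  exact ⟨powerSumEquiv.symm f, rfl⟩

/-! ### Wreath symmetric functions -/

section wreath
variable (ι : Type)

/-- The ring `R = ⨂_i Λ(X_i)` of wreath symmetric functions, realised as the subalgebra of
`ℂ[[x_{i,k}]]` generated by the rings `Λ(X_i)`, `X_i = x_{i,0} + x_{i,1} + ⋯`. -/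
def wreathRing : Subalgebra ℂ (MvPowerSeries (ι × ℕ) ℂ) :=
  ⨆ i : ι, Lam.map (MvPowerSeries.rename (Function.Embedding.sectR i ℕ))

variable {ι}

lemma rename_mem_wreathRing (i : ι) (f : Lam) :
    MvPowerSeries.rename (Function.Embedding.sectR i ℕ) (f : MvPowerSeries ℕ ℂ) ∈ wreathRing ι :=
  le_iSup (fun i : ι => Lam.map (MvPowerSeries.rename (Function.Embedding.sectR i ℕ))) i
    ⟨f, f.2, rfl⟩

/-- `f(X_i)`, the copy of a symmetric function `f` in the variable set `X_i`. -/
def inVars (f : Lam) (i : ι) : wreathRing ι :=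
  ⟨MvPowerSeries.rename (Function.Embedding.sectR i ℕ) (f : MvPowerSeries ℕ ℂ),
    rename_mem_wreathRing i f⟩

/-- `P_ρ = ∏_i p_{ρ(i)}(X_i)`. -/
def wreathP [Fintype ι] (ρ : ι → Par) : wreathRing ι := ∏ i, inVars (pPar (ρ i)) i

lemma rename_pSeries (i : ι) (n : ℕ+) :
    MvPowerSeries.rename (Function.Embedding.sectR i ℕ) (pSeries n) =
      colourPowerSum Prod.fst i n := by
  ext β
  rw [coeff_colourPowerSum]
  by_cases hβ : β ∈ Set.range (Finsupp.mapDomain (Function.Embedding.sectR i ℕ))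
  · obtain ⟨α, rfl⟩ := hβ
    rw [← Finsupp.embDomain_eq_mapDomain, MvPowerSeries.coeff_embDomain_rename]
    change (if ∃ k, α = Finsupp.single k (n : ℕ) then (1 : ℂ) else 0) = _
    refine if_congr ⟨?_, ?_⟩ rfl rfl
    · rintro ⟨k, rfl⟩
      exact ⟨(i, k), rfl, by simp [Finsupp.embDomain_single]⟩
    · rintro ⟨⟨i', k⟩, rfl, hk⟩
      refine ⟨k, Finsupp.embDomain_injective (Function.Embedding.sectR i' ℕ) ?_⟩
      rw [hk, Finsupp.embDomain_single]
      rfl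
  · rw [MvPowerSeries.coeff_rename_eq_zero _ _ hβ, if_neg]
    rintro ⟨⟨i', k⟩, rfl, rfl⟩
    exact hβ ⟨Finsupp.single k n, by rw [Finsupp.mapDomain_single]; rfl⟩

lemma inVars_pPar (lam : Par) (i : ι) : (inVars (pPar lam) i : MvPowerSeries (ι × ℕ) ℂ) =
    colourPowerProd Prod.fst (lam.map fun n => (i, n)) := by
  change MvPowerSeries.rename (Function.Embedding.sectR i ℕ) (Lam.val (pPar lam)) = _
  rw [pPar, map_multiset_prod, map_multiset_prod, colourPowerProd]
  simp only [Multiset.map_map]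
  congr 1
  refine Multiset.map_congr rfl fun n _ => ?_
  exact rename_pSeries i n

/-- The coloured multiset of parts of a family of partitions. -/
def colouredParts [Fintype ι] (ρ : ι → Par) : Multiset (ι × ℕ+) :=
  ∑ i, (ρ i).map fun n => (i, n)

lemma coe_wreathP [Fintype ι] (ρ : ι → Par) : (wreathP ρ : MvPowerSeries (ι × ℕ) ℂ) =
    colourPowerProd Prod.fst (colouredParts ρ) := by
  have hadd : ∀ (T : Finset ι), colourPowerProd (Prod.fst : ι × ℕ → ι)
      (∑ i ∈ T, (ρ i).map fun n => (i, n)) =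
      ∏ i ∈ T, colourPowerProd Prod.fst ((ρ i).map fun n => (i, n)) := by
    intro T
    induction T using Finset.induction_on with
    | empty => simp [colourPowerProd]
    | insert i T hi ih =>
      rw [Finset.sum_insert hi, Finset.prod_insert hi, ← ih]
      simp [colourPowerProd]
  rw [colouredParts, hadd, wreathP]
  change (wreathRing ι).val _ = _
  rw [map_prod]
  exact Finset.prod_congr rfl fun i _ => inVars_pPar (ρ i) i

lemma filter_colouredParts [Fintype ι] (ρ : ι → Par) (j : ι) :
    ((colouredParts ρ).filter fun x => x.1 = j).map Prod.snd = ρ j := by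
  have : ∀ T : Finset ι, ((∑ i ∈ T, (ρ i).map fun n => (i, n)).filter fun x => x.1 = j).map Prod.snd
      = if j ∈ T then ρ j else 0 := by
    intro T
    induction T using Finset.induction_on with
    | empty => simp
    | insert i T hi ih =>
      rw [Finset.sum_insert hi, Multiset.filter_add, Multiset.map_add, ih, Multiset.filter_map,
        Multiset.map_map]
      by_cases hij : i = j
      · subst hij; simp [hi]
      · simp [hij, Ne.symm hij]
  simpa [colouredParts] using this Finset.univ

lemma colouredParts_injective [Fintype ι] : Function.Injective (colouredParts (ι := ι)) := by
  intro ρ ρ' hρ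
  funext j
  rw [← filter_colouredParts ρ j, hρ, filter_colouredParts]

lemma colouredParts_surjective [Fintype ι] : Function.Surjective (colouredParts (ι := ι)) := by
  intro s
  refine ⟨fun j => (s.filter fun x => x.1 = j).map Prod.snd, ?_⟩
  induction s using Multiset.induction_on with
  | empty => simp [colouredParts]
  | cons x s ih =>
    conv_rhs => rw [← ih]
    unfold colouredParts
    have : ∀ i, (((x ::ₘ s).filter fun y => y.1 = i).map Prod.snd).map (fun n => (i, n)) =
        (if x.1 = i then {x} else 0) +
          ((s.filter fun y => y.1 = i).map Prod.snd).map fun n => (i, n) := by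
      intro i
      by_cases hx : x.1 = i
      · subst hx; simp
      · simp [hx]
    simp only [this, Finset.sum_add_distrib, Finset.sum_ite_eq, Finset.mem_univ, if_true,
      Multiset.singleton_add]

lemma linearIndependent_wreathP [Fintype ι] :
    LinearIndependent ℂ (wreathP : (ι → Par) → wreathRing ι) := by
  have hli := (linearIndependent_colourPowerProd (Prod.fst : ι × ℕ → ι) (fun i => by
    refine (Set.infinite_range_of_injective
      (Function.Embedding.sectR i ℕ).injective).mono ?_
    rintro _ ⟨k, rfl⟩; rfl)).comp _ (colouredParts_injective (ι := ι))
  refine LinearIndependent.of_comp (wreathRing ι).val.toLinearMap ?_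
  have heq : (⇑(wreathRing ι).val.toLinearMap ∘ wreathP) =
      colourPowerProd (Prod.fst : ι × ℕ → ι) ∘ colouredParts := funext fun ρ => coe_wreathP ρ
  rw [heq]
  exact hli

lemma wreathRing_le_adjoin : wreathRing ι ≤ Algebra.adjoin ℂ
    (Set.range fun x : ι × ℕ+ => colourPowerSum (Prod.fst : ι × ℕ → ι) x.1 x.2) := by
  refine iSup_le fun i => ?_
  rintro _ ⟨f, hf, rfl⟩
  obtain ⟨q, hq⟩ := powerSumEquiv.surjective ⟨f, hf⟩
  have hcomp : ((MvPowerSeries.rename (Function.Embedding.sectR i ℕ)).comp Lam.val).comp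
      (powerSumEquiv : MvPolynomial ℕ+ ℂ →ₐ[ℂ] Lam) =
      MvPolynomial.aeval fun n : ℕ+ => colourPowerSum (Prod.fst : ι × ℕ → ι) i n := by
    ext1 n
    simpa [powerSumEquiv, p] using rename_pSeries i n
  have hf' : MvPowerSeries.rename (Function.Embedding.sectR i ℕ) f =
      MvPolynomial.aeval (fun n : ℕ+ => colourPowerSum (Prod.fst : ι × ℕ → ι) i n) q := by
    rw [← hcomp, AlgHom.comp_apply, AlgHom.comp_apply]
    exact congrArg _ (congrArg Lam.val hq.symm)
  have hmem : MvPolynomial.aeval (fun n : ℕ+ => colourPowerSum (Prod.fst : ι × ℕ → ι) i n) q ∈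
      Algebra.adjoin ℂ (Set.range fun n : ℕ+ => colourPowerSum (Prod.fst : ι × ℕ → ι) i n) := by
    rw [Algebra.adjoin_range_eq_range_aeval]
    exact ⟨q, rfl⟩
  rw [← hf'] at hmem
  refine Algebra.adjoin_mono ?_ hmem
  rintro _ ⟨n, rfl⟩
  exact ⟨(i, n), rfl⟩

lemma span_wreathP [Fintype ι] :
    ⊤ ≤ Submodule.span ℂ (Set.range (wreathP : (ι → Par) → wreathRing ι)) := by
  rintro ⟨f, hf⟩ -
  have := wreathRing_le_adjoin hf
  rw [Algebra.adjoin_range_eq_range_aeval] at this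
  obtain ⟨q, hq⟩ := this
  have key : f ∈ Submodule.span ℂ
      (Set.range fun ρ : ι → Par => (wreathP ρ : MvPowerSeries (ι × ℕ) ℂ)) := by
    rw [← hq, ← q.support_sum_monomial_coeff]
    change MvPolynomial.aeval _ _ ∈ _
    rw [map_sum]
    refine Submodule.sum_mem _ fun d _ => ?_
    have : MvPolynomial.monomial d (q.coeff d) = q.coeff d • MvPolynomial.monomial d (1 : ℂ) := by
      rw [MvPolynomial.smul_monomial, smul_eq_mul, mul_one]
    rw [this, map_smul, aeval_monomial_colourPowerSum]
    obtain ⟨ρ, hρ⟩ := colouredParts_surjective (Finsupp.toMultiset d)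
    rw [← hρ, ← coe_wreathP]
    exact Submodule.smul_mem _ _ (Submodule.subset_span ⟨ρ, rfl⟩)
  have hmap : (Submodule.span ℂ (Set.range (wreathP : (ι → Par) → wreathRing ι))).map
      (wreathRing ι).val.toLinearMap = Submodule.span ℂ
      (Set.range fun ρ : ι → Par => (wreathP ρ : MvPowerSeries (ι × ℕ) ℂ)) := by
    rw [Submodule.map_span, ← Set.range_comp]
    rfl
  rw [← hmap] at key
  obtain ⟨g, hg, hgf⟩ := key
  rwa [show (⟨f, hf⟩ : wreathRing ι) = g from Subtype.ext hgf.symm]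

/-- The basis `(P_ρ)` of `R`. -/
def wreathBasis (ι : Type) [Fintype ι] : Module.Basis (ι → Par) ℂ (wreathRing ι) :=
  Module.Basis.mk linearIndependent_wreathP span_wreathP

/-- `Z_ρ = ∏_i z_{ρ(i)} m ^ ℓ(ρ(i))`, where `m` is the number of variable sets. -/
def zWreath [Fintype ι] (ρ : ι → Par) : ℕ :=
  ∏ i, zPar (ρ i) * Fintype.card ι ^ (ρ i).card

/-- The bilinear pairing on `R` with `(P_ρ, P_γ) = δ_{ρ,γ} Z_ρ`. -/
def wreathPairing [Fintype ι] : wreathRing ι →ₗ[ℂ] wreathRing ι →ₗ[ℂ] ℂ :=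
  (wreathBasis ι).constr ℂ fun ρ => (wreathBasis ι).constr ℂ fun γ =>
    if ρ = γ then (zWreath ρ : ℂ) else 0

/-- `∑ a_ρ P_ρ ↦ ∑ conj(a_ρ) P_ρ`. -/
def wreathConj [Fintype ι] (f : wreathRing ι) : wreathRing ι :=
  ((wreathBasis ι).repr f).sum fun ρ a => (starRingEnd ℂ) a • wreathP ρ

/-- The coefficient of `y^β` in a series in the variables `x_{i,k}` and `y_k`. -/
def coeffY (β : ℕ →₀ ℕ) (F : MvPowerSeries ((ι × ℕ) ⊕ ℕ) ℂ) : MvPowerSeries (ι × ℕ) ℂ :=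
  fun α => MvPowerSeries.coeff (Finsupp.sumElim α β) F

/-- The pairing `(F, f)` of a series `F` in the `x_{i,k}` and `y_k` with `f ∈ R`, extended linearly
over series in `Y` and over infinite sums of homogeneous elements of `R`: the coefficient of `y^β`
in `(F, f)` is `∑_d (F_{β,d}, f)`, where `F_{β,d}` is the component of degree `d` in the `x_{i,k}`
of the coefficient of `y^β` in `F`. (It is meant for `F` all of whose `F_{β,d}` lie in `R`;
other components are ignored.) -/
def seriesPairing [Fintype ι] (F : MvPowerSeries ((ι × ℕ) ⊕ ℕ) ℂ) (f : wreathRing ι) :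
    MvPowerSeries ℕ ℂ :=
  fun β => ∑ᶠ d : ℕ,
    if hR : MvPowerSeries.homogeneousComponent d (coeffY β F) ∈ wreathRing ι then
      wreathPairing ⟨MvPowerSeries.homogeneousComponent d (coeffY β F), hR⟩ f
    else 0

end wreath

/-! ### The kernel and the functions `S_ρ`, `G_ρ` -/

section kernel
open scoped MvPowerSeries.WithPiTopology

/-- The plethystic exponential `Ω(A) = ∑_{n ≥ 0} h_n(A)`. -/
def plethExp {τ : Type*} (A : MvPowerSeries τ ℂ) : MvPowerSeries τ ℂ := ∑' n : ℕ, pleth A (h n)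

/-- `Ω(Y; z) = ∏_i (1 - z y_i)⁻¹`. -/
def OmegaAt (z : ℂ) : MvPowerSeries ℕ ℂ :=
  ∏' i : ℕ, (1 - z • (MvPowerSeries.X i : MvPowerSeries ℕ ℂ))⁻¹

/-- `∑_{k ≥ 0} h_{km+j}(Y)`. -/
def hProgression (m j : ℕ) : MvPowerSeries ℕ ℂ := ∑' k : ℕ, (h (k * m + j) : MvPowerSeries ℕ ℂ)

variable (m : ℕ) [NeZero m]

/-- `μ_m`, the group of `m`-th roots of unity in `ℂ`. -/
abbrev Mu (m : ℕ) : Type := rootsOfUnity m ℂ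

instance : Fintype (Mu m) := Fintype.ofFinite _

/-- `ζ_m = exp(2πi/m)` as an element of `μ_m`. -/
def zetaM : Mu m := (Complex.isPrimitiveRoot_exp m (NeZero.ne m)).toRootsOfUnity

/-- The complex number underlying a root of unity. -/
def muVal {m : ℕ} (ζ : Mu m) : ℂ := ((ζ : ℂˣ) : ℂ)

/-- `φ_j(𝔛) = (1/m) ∑_ζ ζ^j X_ζ`, with `X_ζ = x_{ζ,0} + x_{ζ,1} + ⋯ = p_1(X_ζ)`. -/
def phi (j : ℕ) : MvPowerSeries (Mu m × ℕ) ℂ :=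
  (1 / (m : ℂ)) • ∑ ζ : Mu m, muVal ζ ^ j • (inVars (p 1) ζ : MvPowerSeries (Mu m × ℕ) ℂ)

lemma expand_colourPowerSum {σ ι : Type*} (c : σ → ι) (i : ι) (n : ℕ+) :
    MvPowerSeries.expand (n : ℕ) n.ne_zero (colourPowerSum c i 1) = colourPowerSum c i n := by
  ext β
  by_cases hβ : ∃ α, β = (n : ℕ) • α
  · obtain ⟨α, rfl⟩ := hβ
    rw [MvPowerSeries.coeff_expand_smul, coeff_colourPowerSum, coeff_colourPowerSum]
    refine if_congr (exists_congr fun v => and_congr_right fun _ => ?_) rfl rfl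
    have : Finsupp.single v (n : ℕ) = (n : ℕ) • Finsupp.single v 1 := by simp
    rw [this]
    exact (nsmul_right_inj n.ne_zero).symm
  · rw [coeff_colourPowerSum, if_neg]
    · by_contra hne
      obtain ⟨α, -, hα⟩ := MvPowerSeries.support_expand_subset (n : ℕ) n.ne_zero _ hne
      exact hβ ⟨α, hα.symm⟩
    · rintro ⟨v, -, rfl⟩
      exact hβ ⟨Finsupp.single v 1, by simp⟩

lemma expand_phi_mem (j : ℕ) (n : ℕ+) :
    MvPowerSeries.expand (n : ℕ) n.ne_zero (phi m j) ∈ wreathRing (Mu m) := by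
  rw [phi, map_smul, map_sum]
  refine Subalgebra.smul_mem _ (Subalgebra.sum_mem _ fun ζ _ => ?_) _
  rw [map_smul]
  refine Subalgebra.smul_mem _ ?_ _
  change MvPowerSeries.expand (n : ℕ) n.ne_zero
    (MvPowerSeries.rename (Function.Embedding.sectR ζ ℕ) (pSeries 1)) ∈ _
  rw [rename_pSeries, PNat.one_coe, expand_colourPowerSum, ← rename_pSeries]
  exact rename_mem_wreathRing ζ (p n)

/-- `S_ρ(𝔛) = ∏_{1 ≤ j ≤ m} s_{ρ(ζ_m^j)}(φ_j(𝔛))`. -/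
def wreathS (ρ : Mu m → Par) : wreathRing (Mu m) :=
  ∏ j ∈ Finset.Icc 1 m, ⟨pleth (phi m j) (schur (ρ (zetaM m ^ j))),
    pleth_mem _ _ (expand_phi_mem m j) _⟩

/-- The series `(1/m) ∑_ζ X_ζ Ω(Y;ζ)`. -/
def kernelAlphabet : MvPowerSeries ((Mu m × ℕ) ⊕ ℕ) ℂ :=
  (1 / (m : ℂ)) • ∑ ζ : Mu m,
    MvPowerSeries.rename (Function.Embedding.inl : Mu m × ℕ ↪ (Mu m × ℕ) ⊕ ℕ)
        (inVars (p 1) ζ : MvPowerSeries (Mu m × ℕ) ℂ) *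
      MvPowerSeries.rename (Function.Embedding.inr : ℕ ↪ (Mu m × ℕ) ⊕ ℕ) (OmegaAt (muVal ζ))

/-- `G_ρ(Y) = (Ω((1/m) ∑_ζ X_ζ Ω(Y;ζ)), conj S_ρ(𝔛))`. -/
def G (ρ : Mu m → Par) : MvPowerSeries ℕ ℂ :=
  seriesPairing (plethExp (kernelAlphabet m)) (wreathConj (wreathS m ρ))

end kernel

end

end WreathSym

/-!
The kernel `Ω((1/m) ∑_i X_i g_i(Y))` is reproducing: pairing it with `f ∈ R` substitutes
`p_r(X_i) ↦ p_r(g_i)` in `f`. Indeed `Ω(A) = exp (∑_r p_r(A) / r)` expands into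
`∑_ρ Z_ρ⁻¹ P_ρ(X) P_ρ(g)`. By Newton's identities it suffices that the weight-`n` parts of this sum
satisfy the recursion of the `h_n`, which follows by marking a part of each coloured multiset.

With `g_ζ = Ω(Y; ζ)`, the series `G_ρ(Y)` is therefore the image of the conjugate of `S_ρ` under
`p_r(X_ζ) ↦ p_r(Ω(Y; ζ))`. Conjugation and this substitution together turn `p_r(φ_j)` into `p_r` of
`(1/m) ∑_ζ ζ^{-j} Ω(Y; ζ) = ∑_k h_{km+j}(Y)`, by orthogonality of the characters of `μ_m`.
Conjugation is only semilinear, but Schur functions are integer polynomials in the `h_n`, so their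
images under a ring homomorphism to a torsion-free ring depend only on the images of the `p_n`.
-/

namespace WreathSym

noncomputable section

open scoped Finset MvPowerSeries.WithPiTopology

section powerSeries

variable {σ τ R : Type*}

instance isAddTorsionFree_mvPowerSeries [Semiring R] [IsAddTorsionFree R] :
    IsAddTorsionFree (MvPowerSeries σ R) :=
  inferInstanceAs (IsAddTorsionFree ((σ →₀ ℕ) → R))

theorem coeff_tsum_of_ne [Semiring R] [TopologicalSpace R] [T2Space R] {κ : Type*}
    {F : κ → MvPowerSeries σ R} (N : (σ →₀ ℕ) → κ)
    (hF : ∀ α n, n ≠ N α → MvPowerSeries.coeff α (F n) = 0) (α : σ →₀ ℕ) :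
    MvPowerSeries.coeff α (∑' n, F n) = MvPowerSeries.coeff α (F (N α)) := by
  have hsum : HasSum F (fun β => MvPowerSeries.coeff β (F (N β))) :=
    MvPowerSeries.WithPiTopology.hasSum_iff_hasSum_coeff.2 fun β =>
      hasSum_single (N β) fun n hn => hF β n hn
  rw [hsum.tsum_eq]
  rfl

theorem expand_rename [CommRing R] (e : σ ↪ τ) {n : ℕ} (hn : n ≠ 0) (f : MvPowerSeries σ R) :
    MvPowerSeries.expand n hn (MvPowerSeries.rename e f) =
      MvPowerSeries.rename e (MvPowerSeries.expand n hn f) := by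
  have hX : MvPowerSeries.HasSubst (MvPowerSeries.X ∘ e : σ → MvPowerSeries τ R) :=
    MvPowerSeries.HasSubst.X_comp e
  rw [MvPowerSeries.rename_eq_subst, MvPowerSeries.rename_eq_subst,
    MvPowerSeries.expand_subst n hn hX, MvPowerSeries.expand.eq_def (σ := σ),
    MvPowerSeries.substAlgHom_apply,
    MvPowerSeries.subst_comp_subst_apply (MvPowerSeries.HasSubst.X_pow hn) hX]
  congr 1
  funext i
  rw [MvPowerSeries.subst_pow hX, MvPowerSeries.subst_X hX, Function.comp_apply,
    MvPowerSeries.expand_X]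

theorem coeff_sumElim_rename_inl_mul_rename_inr [CommSemiring R] (f : MvPowerSeries σ R)
    (g : MvPowerSeries τ R) (α : σ →₀ ℕ) (β : τ →₀ ℕ) :
    MvPowerSeries.coeff (Finsupp.sumElim α β)
      (MvPowerSeries.rename (Function.Embedding.inl : σ ↪ σ ⊕ τ) f *
        MvPowerSeries.rename (Function.Embedding.inr : τ ↪ σ ⊕ τ) g) =
      MvPowerSeries.coeff α f * MvPowerSeries.coeff β g := by
  classical
  rw [MvPowerSeries.coeff_mul, Finset.sum_eq_single
    (Finsupp.embDomain Function.Embedding.inl α, Finsupp.embDomain Function.Embedding.inr β),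
    MvPowerSeries.coeff_embDomain_rename, MvPowerSeries.coeff_embDomain_rename]
  · rintro ⟨a, b⟩ hab hne
    by_contra hcoeff
    obtain ⟨a, rfl⟩ := not_imp_comm.1 (MvPowerSeries.coeff_rename_eq_zero _ f)
      (left_ne_zero_of_mul hcoeff)
    obtain ⟨b, rfl⟩ := not_imp_comm.1 (MvPowerSeries.coeff_rename_eq_zero _ g)
      (right_ne_zero_of_mul hcoeff)
    have hadd : Finsupp.sumElim a b = Finsupp.sumElim α β :=
      (Finsupp.sumElim_eq_add _ _).trans (Finset.HasAntidiagonal.mem_antidiagonal.1 hab)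
    obtain ⟨rfl, rfl⟩ := Prod.ext_iff.1 (Finsupp.sumFinsuppEquivProdFinsupp.symm.injective
      (a₁ := (a, b)) (a₂ := (α, β)) hadd)
    exact hne (by simp only [Finsupp.embDomain_eq_mapDomain])
  · refine fun hnot => absurd (Finset.HasAntidiagonal.mem_antidiagonal.2 ?_) hnot
    simp only [Finsupp.embDomain_eq_mapDomain]
    exact (Finsupp.sumElim_eq_add _ _).symm

end powerSeries

section newton

theorem coeff_hSeries (n : ℕ) (α : ℕ →₀ ℕ) :
    MvPowerSeries.coeff α (hSeries n) = if α.degree = n then 1 else 0 := rfl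

theorem coeff_pSeries_mul (k : ℕ+) (f : MvPowerSeries ℕ ℂ) (α : ℕ →₀ ℕ) :
    MvPowerSeries.coeff α (pSeries k * f) =
      ∑ i ∈ α.support with k ≤ α i, MvPowerSeries.coeff (α - Finsupp.single i (k : ℕ)) f := by
  classical
  have coeff_pSeries (β : ℕ →₀ ℕ) : MvPowerSeries.coeff β (pSeries k) =
      if ∃ i, β = Finsupp.single i (k : ℕ) then 1 else 0 := by
    unfold pSeries
    exact if_congr Iff.rfl rfl rfl
  rw [MvPowerSeries.coeff_mul, eq_comm]
  refine Finset.sum_of_injOn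
    (fun i => (Finsupp.single i (k : ℕ), α - Finsupp.single i (k : ℕ))) ?_ ?_ ?_ ?_
  · exact fun i _ j _ hij => (Finsupp.single_left_inj k.ne_zero).1 (congrArg Prod.fst hij)
  · intro i hi
    have hle : Finsupp.single i (k : ℕ) ≤ α := by
      simpa using (Finset.mem_filter.1 hi).2
    exact Finset.mem_coe.2 (Finset.HasAntidiagonal.mem_antidiagonal.2 (add_tsub_cancel_of_le hle))
  · rintro ⟨a, b⟩ hab hnot
    rw [coeff_pSeries, if_neg, zero_mul]
    rintro ⟨i, rfl⟩
    refine hnot ⟨i, ?_, ?_⟩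
    · simp [← Finset.HasAntidiagonal.mem_antidiagonal.1 hab]
    · simp [← Finset.HasAntidiagonal.mem_antidiagonal.1 hab]
  · intro i _
    rw [coeff_pSeries, if_pos ⟨i, rfl⟩, one_mul]

theorem coeff_pSeries_mul_hSeries {k n : ℕ+} (hk : k ≤ n) (α : ℕ →₀ ℕ) :
    MvPowerSeries.coeff α (pSeries k * hSeries (n - k)) =
      if α.degree = n then (#{i ∈ α.support | k ≤ α i} : ℂ) else 0 := by
  have hcoeff : ∀ i ∈ α.support.filter (fun i => k ≤ α i),
      MvPowerSeries.coeff (α - Finsupp.single i (k : ℕ)) (hSeries (n - k)) =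
        if α.degree = n then 1 else 0 := by
    intro i hi
    have hki : (k : ℕ) ≤ α i := (Finset.mem_filter.1 hi).2
    have hdeg : (α - Finsupp.single i (k : ℕ)).degree + k = α.degree := by
      have := congrArg Finsupp.degree
        (tsub_add_cancel_of_le (a := Finsupp.single i (k : ℕ)) (b := α) (by simpa using hki))
      rwa [map_add, Finsupp.degree_single] at this
    have hkn : (k : ℕ) ≤ n := hk
    rw [coeff_hSeries]
    exact if_congr (by omega) rfl rfl
  rw [coeff_pSeries_mul, Finset.sum_congr rfl hcoeff, Finset.sum_const]
  split_ifs <;> simp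

theorem sum_card_filter_le_eq_degree {σ : Type*} (α : σ →₀ ℕ) {n : ℕ+} (hα : α.degree ≤ n) :
    ∑ k ∈ Finset.Icc 1 n, #{i ∈ α.support | (k : ℕ) ≤ α i} = α.degree := by
  classical
  have hcard : ∀ i ∈ α.support, #((Finset.Icc 1 n).filter fun k : ℕ+ => (k : ℕ) ≤ α i) = α i := by
    intro i hi
    obtain ⟨a, ha⟩ : ∃ a : ℕ+, (a : ℕ) = α i :=
      CanLift.prf (α i) (Nat.pos_of_ne_zero (Finsupp.mem_support_iff.1 hi))
    have han : a ≤ n := PNat.coe_le_coe _ _ |>.1 (ha ▸ (Finsupp.le_degree i α).trans hα)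
    have : ((Finset.Icc 1 n).filter fun k : ℕ+ => (k : ℕ) ≤ α i) = Finset.Icc 1 a := by
      ext k
      simp only [← ha, PNat.coe_le_coe, Finset.mem_filter, Finset.mem_Icc, one_le, true_and]
      exact ⟨And.right, fun hk => ⟨hk.trans han, hk⟩⟩
    rw [this, PNat.card_Icc, ← ha, PNat.one_coe, Nat.add_sub_cancel]
  simp only [Finset.card_filter] at hcard ⊢
  rw [Finset.sum_comm, Finset.sum_congr rfl hcard, Finsupp.degree_apply]

theorem h_zero : h 0 = 1 := by
  apply Subtype.ext
  ext α
  rw [OneMemClass.coe_one, MvPowerSeries.coeff_one]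
  exact (coeff_hSeries 0 α).trans (if_congr (Finsupp.degree_eq_zero_iff α) rfl rfl)

theorem newton (n : ℕ+) :
    (n : ℕ) • h n = ∑ k ∈ Finset.Icc 1 n, p k * h (n - k : ℕ) := by
  apply Subtype.ext
  change (Lam.val ((n : ℕ) • h n)) = Lam.val (∑ k ∈ Finset.Icc 1 n, p k * h (n - k : ℕ))
  simp only [map_nsmul, map_sum, map_mul]
  change (n : ℕ) • hSeries n = ∑ k ∈ Finset.Icc 1 n, pSeries k * hSeries (n - k)
  ext α
  rw [map_nsmul, coeff_hSeries, map_sum, Finset.sum_congr rfl fun k hk =>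
    coeff_pSeries_mul_hSeries (Finset.mem_Icc.1 hk).2 α]
  split_ifs with hα
  · rw [← Nat.cast_sum, sum_card_filter_le_eq_degree α hα.le, hα, nsmul_one]
  · simp

variable {B : Type*} [CommRing B] [IsAddTorsionFree B] {φ ψ : Lam →+* B}

theorem ringHom_h_eq (hp : ∀ n, φ (p n) = ψ (p n)) (n : ℕ) : φ (h n) = ψ (h n) := by
  induction n using Nat.strong_induction_on with
  | _ n ih =>
    obtain rfl | hn := n.eq_zero_or_pos
    · rw [h_zero, map_one, map_one]
    lift n to ℕ+ using hn
    refine nsmul_right_injective n.ne_zero ?_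
    simp only [← map_nsmul, newton, map_sum, map_mul]
    refine Finset.sum_congr rfl fun k _ => ?_
    rw [hp, ih _ (Nat.sub_lt n.pos k.pos)]

theorem ringHom_schur_eq (hp : ∀ n, φ (p n) = ψ (p n)) (lam : Par) :
    φ (schur lam) = ψ (schur lam) := by
  have hInt_eq : ∀ k, φ (hInt k) = ψ (hInt k)
    | .ofNat k => ringHom_h_eq hp k
    | .negSucc _ => (map_zero φ).trans (map_zero ψ).symm
  rw [schur, RingHom.map_det, RingHom.map_det]
  congr 1
  ext i j
  exact hInt_eq _

end newton

section geometric

variable {σ K : Type*} [Field K]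

theorem coeff_inv_one_sub_smul_X_mul (z : K) (i : σ) (f : MvPowerSeries σ K) (α : σ →₀ ℕ) :
    MvPowerSeries.coeff α ((1 - z • MvPowerSeries.X i)⁻¹ * f) =
      MvPowerSeries.coeff α f + if α i = 0 then 0 else z * MvPowerSeries.coeff
        (α - Finsupp.single i 1) ((1 - z • MvPowerSeries.X i)⁻¹ * f) := by
  classical
  set F := (1 - z • MvPowerSeries.X i)⁻¹ * f with hF
  have hconst :
      MvPowerSeries.constantCoeff (1 - z • (MvPowerSeries.X i : MvPowerSeries σ K)) ≠ 0 := by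
    simp [MvPowerSeries.smul_eq_C_mul]
  have hrec : F = f + MvPowerSeries.monomial (Finsupp.single i 1) z * F := by
    have hmul : (1 - z • MvPowerSeries.X i) * F = f := by
      rw [hF, ← mul_assoc, MvPowerSeries.mul_inv_cancel _ hconst, one_mul]
    rw [← hmul, MvPowerSeries.X, ← map_smul, smul_eq_mul, mul_one]
    ring
  conv_lhs => rw [hrec]
  rw [map_add, MvPowerSeries.coeff_monomial_mul]
  simp only [Finsupp.single_le_iff, Nat.one_le_iff_ne_zero, ite_not]

theorem coeff_prod_inv_one_sub_smul_X [DecidableEq σ] (z : K) (s : Finset σ) (α : σ →₀ ℕ) :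
    MvPowerSeries.coeff α (∏ i ∈ s, (1 - z • (MvPowerSeries.X i : MvPowerSeries σ K))⁻¹) =
      if α.support ⊆ s then z ^ α.degree else 0 := by
  induction s using Finset.induction_on generalizing α with
  | empty =>
    rw [Finset.prod_empty, MvPowerSeries.coeff_one]
    by_cases hα : α = 0 <;> simp [hα]
  | insert i s hi ih =>
    rw [Finset.prod_insert hi]
    induction hn : α i generalizing α with
    | zero =>
      rw [coeff_inv_one_sub_smul_X_mul, if_pos hn, add_zero, ih]
      exact if_congr (Finset.subset_insert_iff_of_notMem (by simpa using hn)).symm rfl rfl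
    | succ n hrec =>
      obtain ⟨β, rfl⟩ : ∃ β, α = β + Finsupp.single i 1 :=
        ⟨α - Finsupp.single i 1, (tsub_add_cancel_of_le (by simp [hn])).symm⟩
      have hsupp : (β + Finsupp.single i 1).support = insert i β.support := by
        ext j
        by_cases hj : j = i <;> simp [hj]
      have hnot : ¬ insert i β.support ⊆ s := fun hsub => hi (hsub (Finset.mem_insert_self _ _))
      rw [coeff_inv_one_sub_smul_X_mul, if_neg (by simp), add_tsub_cancel_right,
        hrec β (by simpa using hn), ih, hsupp, if_neg hnot, zero_add, mul_ite, mul_zero,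
        ← pow_succ', map_add, Finsupp.degree_single]
      simp [Finset.insert_subset_iff]

theorem hasProd_inv_one_sub_smul_X [TopologicalSpace K] (z : K) :
    HasProd (fun i : σ => (1 - z • (MvPowerSeries.X i : MvPowerSeries σ K))⁻¹)
      (fun α => z ^ α.degree) := by
  classical
  refine (MvPowerSeries.WithPiTopology.tendsto_iff_coeff_tendsto _ _ _).2 fun α =>
    tendsto_const_nhds.congr' ?_
  filter_upwards [Filter.eventually_ge_atTop α.support] with s hs
  rw [coeff_prod_inv_one_sub_smul_X, if_pos hs]
  rfl

theorem coeff_OmegaAt (z : ℂ) (α : ℕ →₀ ℕ) :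
    MvPowerSeries.coeff α (OmegaAt z) = z ^ α.degree := by
  rw [OmegaAt, (hasProd_inv_one_sub_smul_X z).tprod_eq]
  rfl

theorem coeff_hProgression {m j : ℕ} (hj : j < m) (α : ℕ →₀ ℕ) :
    MvPowerSeries.coeff α (hProgression m j) = if α.degree % m = j then 1 else 0 := by
  have hvanish (β : ℕ →₀ ℕ) (k : ℕ) (hk : k ≠ β.degree / m) :
      MvPowerSeries.coeff β (h (k * m + j) : MvPowerSeries ℕ ℂ) = 0 := by
    refine (coeff_hSeries _ β).trans (if_neg fun hdeg => hk ?_)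
    rw [hdeg, mul_comm, Nat.mul_add_div (by omega), Nat.div_eq_of_lt hj, add_zero]
  rw [hProgression, coeff_tsum_of_ne (fun β => β.degree / m) hvanish]
  refine (coeff_hSeries _ α).trans (if_congr ?_ rfl rfl)
  have := Nat.div_add_mod' α.degree m
  omega

end geometric

section multiset

variable {κ : Type*} [DecidableEq κ]

/-- `∏_x m_x! a(x) ^ m_x`, where `m_x` is the multiplicity of `x` in `s`: the common form of the
normalisations `z_λ` and `Z_ρ`. -/
def zWeighted (a : κ → ℕ) (s : Multiset κ) : ℕ :=
  ∏ x ∈ s.toFinset, (s.count x).factorial * a x ^ s.count x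

theorem zWeighted_eq_prod_of_subset (a : κ → ℕ) {s : Multiset κ} {T : Finset κ}
    (hT : s.toFinset ⊆ T) :
    zWeighted a s = ∏ x ∈ T, (s.count x).factorial * a x ^ s.count x := by
  refine Finset.prod_subset hT fun x _ hx => ?_
  rw [Multiset.mem_toFinset] at hx
  simp [Multiset.count_eq_zero_of_notMem hx]

theorem zWeighted_cons (a : κ → ℕ) (x : κ) (s : Multiset κ) :
    zWeighted a (x ::ₘ s) = (s.count x + 1) * a x * zWeighted a s := by
  have hx : x ∈ insert x s.toFinset := Finset.mem_insert_self _ _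
  have hne : ∀ y ∈ (insert x s.toFinset).erase x,
      ((x ::ₘ s).count y).factorial * a y ^ (x ::ₘ s).count y =
        (s.count y).factorial * a y ^ s.count y := fun y hy => by
    rw [Multiset.count_cons_of_ne (Finset.ne_of_mem_erase hy)]
  rw [zWeighted_eq_prod_of_subset a (Finset.subset_insert x s.toFinset),
    zWeighted_eq_prod_of_subset a (Multiset.toFinset_cons x s).subset,
    ← Finset.mul_prod_erase _ _ hx, ← Finset.mul_prod_erase _ _ hx, Finset.prod_congr rfl hne,
    Multiset.count_cons_self, Nat.factorial_succ, pow_succ]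
  ring

theorem zWeighted_ne_zero {a : κ → ℕ} {s : Multiset κ} (ha : ∀ x ∈ s, a x ≠ 0) :
    zWeighted a s ≠ 0 :=
  Finset.prod_ne_zero_iff.2 fun x hx => mul_ne_zero (Nat.factorial_ne_zero _)
    (pow_ne_zero _ (ha x (Multiset.mem_toFinset.1 hx)))

theorem zWeighted_const_mul (c : ℕ) (a : κ → ℕ) (s : Multiset κ) :
    zWeighted (fun x => c * a x) s = zWeighted a s * c ^ s.card := by
  rw [← s.toFinset_sum_count_eq, ← Finset.prod_pow_eq_pow_sum, zWeighted, zWeighted,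
    ← Finset.prod_mul_distrib]
  refine Finset.prod_congr rfl fun x _ => ?_
  rw [mul_pow]
  ring

end multiset

section colouredMultiset

variable {ι : Type*}

/-- The sum of the parts of a coloured multiset. -/
def weight (s : Multiset (ι × ℕ+)) : ℕ := (s.map fun x => (x.2 : ℕ)).sum

theorem weight_cons (x : ι × ℕ+) (s : Multiset (ι × ℕ+)) :
    weight (x ::ₘ s) = x.2 + weight s := by
  simp only [weight, Multiset.map_cons, Multiset.sum_cons]

theorem le_weight_of_mem {x : ι × ℕ+} {s : Multiset (ι × ℕ+)} (hx : x ∈ s) :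
    (x.2 : ℕ) ≤ weight s :=
  Multiset.le_sum_of_mem (Multiset.mem_map_of_mem (fun x : ι × ℕ+ => (x.2 : ℕ)) hx)

theorem card_le_weight (s : Multiset (ι × ℕ+)) : s.card ≤ weight s := by
  have hone : ∀ k ∈ s.map (fun x => (x.2 : ℕ)), 1 ≤ k := by
    simp only [Multiset.mem_map]
    rintro _ ⟨x, -, rfl⟩
    exact x.2.pos
  have hle := Multiset.card_nsmul_le_sum hone
  rwa [Multiset.card_map, smul_eq_mul, mul_one] at hle

theorem weight_eq_sum_count [DecidableEq ι] (s : Multiset (ι × ℕ+)) :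
    weight s = ∑ x ∈ s.toFinset, s.count x * (x.2 : ℕ) := by
  rw [weight, Finset.sum_multiset_map_count]
  rfl

theorem finite_setOf_weight_eq [Finite ι] (n : ℕ) :
    {s : Multiset (ι × ℕ+) | weight s = n}.Finite := by
  classical
  cases nonempty_fintype ι
  let T : Finset (ι × ℕ+) := Finset.univ ×ˢ Finset.Icc 1 n.succPNat
  refine (Set.finite_Iic (n • T.val)).subset ?_
  rintro s rfl
  refine Multiset.le_iff_count.2 fun x => ?_
  by_cases hx : x ∈ s
  · have hxT : x ∈ T := by
      simp only [T, Finset.mem_product, Finset.mem_univ, true_and, Finset.mem_Icc, one_le,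
        ← PNat.coe_le_coe, Nat.succPNat_coe]
      exact (le_weight_of_mem hx).trans (Nat.le_succ _)
    rw [Multiset.count_nsmul, Multiset.count_eq_one_of_mem T.nodup hxT, mul_one]
    exact (s.count_le_card x).trans (card_le_weight s)
  · rw [Multiset.count_eq_zero_of_notMem hx]
    exact Nat.zero_le _

/-- The coloured multisets of weight `n`. -/
def ofWeight (ι : Type*) [Finite ι] (n : ℕ) : Finset (Multiset (ι × ℕ+)) :=
  (finite_setOf_weight_eq n).toFinset

theorem mem_ofWeight [Finite ι] {n : ℕ} {s : Multiset (ι × ℕ+)} :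
    s ∈ ofWeight ι n ↔ weight s = n := by
  simp only [ofWeight, Set.Finite.mem_toFinset, Set.mem_ofPred_eq]

theorem ofWeight_zero [Finite ι] : ofWeight ι 0 = {0} := by
  ext s
  rw [mem_ofWeight, Finset.mem_singleton]
  refine ⟨fun hs => Multiset.card_eq_zero.1 (Nat.le_zero.1 (hs ▸ card_le_weight s)), ?_⟩
  rintro rfl
  rfl

/-- Marking an element `x` of a coloured multiset `s` amounts to choosing `x` and `s.erase x`. -/
theorem sum_ofWeight_sum_toFinset [Fintype ι] [DecidableEq ι] {M : Type*} [AddCommMonoid M]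
    (F : ι × ℕ+ → Multiset (ι × ℕ+) → M) (n : ℕ+) :
    ∑ s ∈ ofWeight ι n, ∑ x ∈ s.toFinset, F x (s.erase x) =
      ∑ k ∈ Finset.Icc 1 n, ∑ i, ∑ t ∈ ofWeight ι (n - k), F (i, k) t := by
  simp only [← Finset.sum_product']
  rw [Finset.sum_sigma', Finset.sum_sigma']
  refine Finset.sum_bij' (fun y _ => ⟨y.2.2, (y.2.1, y.1.erase y.2)⟩)
    (fun y _ => ⟨(y.2.1, y.1) ::ₘ y.2.2, (y.2.1, y.1)⟩) ?_ ?_ ?_ ?_ ?_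
  · rintro ⟨s, x⟩ hy
    simp only [Finset.mem_sigma, mem_ofWeight, Multiset.mem_toFinset] at hy
    have hweight := weight_cons x (s.erase x)
    rw [Multiset.cons_erase hy.2, hy.1] at hweight
    simp only [Finset.mem_sigma, Finset.mem_Icc, Finset.mem_product, mem_ofWeight,
      Finset.mem_univ, one_le, true_and, ← PNat.coe_le_coe]
    omega
  · rintro ⟨k, i, t⟩ hy
    simp only [Finset.mem_sigma, Finset.mem_Icc, Finset.mem_product, mem_ofWeight,
      Finset.mem_univ, one_le, true_and, ← PNat.coe_le_coe] at hy
    simp only [Finset.mem_sigma, mem_ofWeight, Multiset.mem_toFinset, Multiset.mem_cons_self,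
      and_true, weight_cons]
    omega
  · rintro ⟨s, x⟩ hy
    simp only [Finset.mem_sigma, Multiset.mem_toFinset] at hy
    simp only [Multiset.cons_erase hy.2]
  · rintro ⟨k, i, t⟩ -
    simp only [Multiset.erase_cons_head]
  · rintro ⟨s, x⟩ -
    rfl

section exponential

variable (K : Type*) {B : Type*} [Field K] [CommRing B] [Algebra K B] [DecidableEq ι]

/-- The term of the coloured multiset `s` in the expansion of `exp (∑_x u_x / (m r_x))`, where `r_x`
is the size of the coloured part `x`. -/
def expTerm (m : ℕ) (u : ι × ℕ+ → B) (s : Multiset (ι × ℕ+)) : B :=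
  (zWeighted (fun x => m * x.2) s : K)⁻¹ • (s.map u).prod

theorem count_mul_smul_expTerm_cons [CharZero K] (m : ℕ) (u : ι × ℕ+ → B) (x : ι × ℕ+)
    (s : Multiset (ι × ℕ+)) :
    ((x ::ₘ s).count x * x.2 : ℕ) • expTerm K m u (x ::ₘ s) =
      ((m : K)⁻¹ • u x) * expTerm K m u s := by
  have hcount : ((s.count x : K) + 1) ≠ 0 := Nat.cast_add_one_ne_zero _
  have hsize : ((x.2 : ℕ) : K) ≠ 0 := Nat.cast_ne_zero.2 x.2.ne_zero
  rw [expTerm, expTerm, Multiset.map_cons, Multiset.prod_cons, smul_mul_smul_comm,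
    ← Nat.cast_smul_eq_nsmul K, smul_smul, zWeighted_cons, Multiset.count_cons_self]
  congr 1
  push_cast
  rw [mul_inv, mul_inv, mul_inv]
  field_simp

theorem weight_smul_expTerm [CharZero K] (m : ℕ) (u : ι × ℕ+ → B) (s : Multiset (ι × ℕ+)) :
    weight s • expTerm K m u s =
      ∑ x ∈ s.toFinset, ((m : K)⁻¹ • u x) * expTerm K m u (s.erase x) := by
  rw [weight_eq_sum_count, Finset.sum_smul]
  refine Finset.sum_congr rfl fun x hx => ?_
  conv_lhs => rw [← Multiset.cons_erase (Multiset.mem_toFinset.1 hx)]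
  exact count_mul_smul_expTerm_cons K m u x _

theorem nsmul_sum_expTerm [CharZero K] [Fintype ι] (m : ℕ) (u : ι × ℕ+ → B) (n : ℕ+) :
    (n : ℕ) • ∑ s ∈ ofWeight ι n, expTerm K m u s =
      ∑ k ∈ Finset.Icc 1 n, ((m : K)⁻¹ • ∑ i, u (i, k)) *
        ∑ s ∈ ofWeight ι (n - k), expTerm K m u s := by
  have hterm : ∀ s ∈ ofWeight ι n, (n : ℕ) • expTerm K m u s =
      ∑ x ∈ s.toFinset, ((m : K)⁻¹ • u x) * expTerm K m u (s.erase x) := fun s hs => by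
    rw [← weight_smul_expTerm, mem_ofWeight.1 hs]
  rw [Finset.smul_sum, Finset.sum_congr rfl hterm,
    sum_ofWeight_sum_toFinset fun x t => ((m : K)⁻¹ • u x) * expTerm K m u t]
  simp only [Finset.smul_sum, Finset.sum_mul_sum]

end exponential

end colouredMultiset

section colouredParts

variable {ι : Type} [Fintype ι]

theorem count_colouredParts [DecidableEq ι] (ρ : ι → Par) (i : ι) (r : ℕ+) :
    (colouredParts ρ).count (i, r) = (ρ i).count r := by
  rw [colouredParts, Multiset.count_sum', Finset.sum_eq_single i]
  · exact Multiset.count_map_eq_count' _ _ (Prod.mk_right_injective i) r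
  · refine fun j _ hj => Multiset.count_eq_zero_of_notMem fun hmem => hj ?_
    obtain ⟨n, -, hn⟩ := Multiset.mem_map.1 hmem
    exact congrArg Prod.fst hn
  · exact fun hi => absurd (Finset.mem_univ i) hi

theorem zWeighted_colouredParts [DecidableEq ι] (ρ : ι → Par) :
    zWeighted (fun x => Fintype.card ι * x.2) (colouredParts ρ) = zWreath ρ := by
  let T : Finset ℕ+ := Finset.univ.biUnion fun i => (ρ i).toFinset
  have hsub (i : ι) : (ρ i).toFinset ⊆ T :=
    Finset.subset_biUnion_of_mem (fun i => (ρ i).toFinset) (Finset.mem_univ i)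
  have hsub_univ : (colouredParts ρ).toFinset ⊆ Finset.univ ×ˢ T := by
    rintro ⟨i, r⟩ hx
    rw [Multiset.mem_toFinset, ← Multiset.count_pos, count_colouredParts, Multiset.count_pos] at hx
    exact Finset.mem_product.2 ⟨Finset.mem_univ i, hsub i (Multiset.mem_toFinset.2 hx)⟩
  rw [zWeighted_eq_prod_of_subset _ hsub_univ, Finset.prod_product, zWreath]
  refine Finset.prod_congr rfl fun i _ => ?_
  rw [show zPar (ρ i) = zWeighted (fun r : ℕ+ => (r : ℕ)) (ρ i) from rfl, ← zWeighted_const_mul,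
    zWeighted_eq_prod_of_subset _ (hsub i)]
  simp only [count_colouredParts]

end colouredParts

section homogeneous

variable {σ ι : Type*} (c : σ → ι)

theorem isHomogeneous_colourPowerSum (i : ι) (n : ℕ) :
    (colourPowerSum c i n).IsHomogeneous n := by
  intro α hα
  obtain ⟨v, -, rfl⟩ : ∃ v, c v = i ∧ α = Finsupp.single v n := by
    contrapose! hα
    rw [coeff_colourPowerSum, if_neg (by simpa using hα)]
  rw [Finsupp.weight_single, Pi.one_apply, smul_eq_mul, mul_one]

theorem isHomogeneous_colourPowerProd (s : Multiset (ι × ℕ+)) :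
    (colourPowerProd c s).IsHomogeneous (weight s) := by
  induction s using Multiset.induction_on with
  | empty =>
    intro α hα
    obtain rfl : α = 0 := by
      classical
      contrapose! hα
      rw [colourPowerProd, Multiset.map_zero, Multiset.prod_zero, MvPowerSeries.coeff_one,
        if_neg hα]
    exact map_zero _
  | cons x s ih =>
    rw [colourPowerProd_cons, weight_cons]
    exact MvPowerSeries.IsHomogeneous.mul (isHomogeneous_colourPowerSum c x.1 x.2) ih

end homogeneous

section wreathMonomial

variable {ι : Type}

theorem coe_inVars_p (n : ℕ+) (i : ι) :
    (inVars (p n) i : MvPowerSeries (ι × ℕ) ℂ) = colourPowerSum Prod.fst i n :=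
  rename_pSeries i n

/-- The product of the `p_r(X_i)` over the coloured parts `(i, r)` of `s`: the functions `P_ρ`,
indexed by coloured multisets instead of families of partitions. -/
def wreathMonomial (s : Multiset (ι × ℕ+)) : wreathRing ι :=
  (s.map fun x => inVars (p x.2) x.1).prod

theorem coe_wreathMonomial (s : Multiset (ι × ℕ+)) :
    (wreathMonomial s : MvPowerSeries (ι × ℕ) ℂ) = colourPowerProd Prod.fst s := by
  rw [wreathMonomial, ← Subalgebra.coe_val, map_multiset_prod, Multiset.map_map, colourPowerProd]
  exact congrArg Multiset.prod (Multiset.map_congr rfl fun x _ => coe_inVars_p x.2 x.1)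

variable [Fintype ι]

theorem wreathMonomial_colouredParts (ρ : ι → Par) :
    wreathMonomial (colouredParts ρ) = wreathP ρ :=
  Subtype.ext ((coe_wreathMonomial _).trans (coe_wreathP ρ).symm)

theorem wreathBasis_apply (ρ : ι → Par) : wreathBasis ι ρ = wreathP ρ :=
  Module.Basis.mk_apply _ _ ρ

/-- The basis `(P_ρ)` of `R`, indexed by coloured multisets. -/
def wreathMonomialBasis (ι : Type) [Fintype ι] :
    Module.Basis (Multiset (ι × ℕ+)) ℂ (wreathRing ι) :=
  (wreathBasis ι).reindex
    (Equiv.ofBijective colouredParts ⟨colouredParts_injective, colouredParts_surjective⟩)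

theorem wreathMonomialBasis_apply (s : Multiset (ι × ℕ+)) :
    wreathMonomialBasis ι s = wreathMonomial s := by
  obtain ⟨ρ, rfl⟩ := colouredParts_surjective s
  rw [wreathMonomial_colouredParts, ← wreathBasis_apply, wreathMonomialBasis,
    Module.Basis.reindex_apply]
  exact congrArg _ (Equiv.ofBijective_symm_apply_apply _ _ ρ)

theorem wreathPairing_wreathMonomial [DecidableEq ι] (s : Multiset (ι × ℕ+)) (f : wreathRing ι) :
    wreathPairing (wreathMonomial s) f =
      zWeighted (fun x => Fintype.card ι * x.2) s * (wreathMonomialBasis ι).repr f s := by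
  obtain ⟨ρ, rfl⟩ := colouredParts_surjective s
  suffices hlin : wreathPairing (wreathMonomial (colouredParts ρ)) =
      (zWreath ρ : ℂ) • (wreathMonomialBasis ι).coord (colouredParts ρ) by
    rw [hlin, zWeighted_colouredParts]
    rfl
  refine (wreathBasis ι).ext fun γ => ?_
  rw [wreathMonomial_colouredParts, ← wreathBasis_apply, wreathPairing, Module.Basis.constr_basis,
    Module.Basis.constr_basis, LinearMap.smul_apply, Module.Basis.coord_apply, wreathBasis_apply,
    ← wreathMonomial_colouredParts, ← wreathMonomialBasis_apply, Module.Basis.repr_self,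
    Finsupp.single_apply, smul_eq_mul, mul_ite, mul_one, mul_zero]
  exact if_congr (colouredParts_injective.eq_iff.trans eq_comm).symm rfl rfl

end wreathMonomial

section wreathLift

variable {ι : Type} [Fintype ι] {B : Type*} [CommRing B] [Algebra ℂ B] (v : ι × ℕ+ → B)

/-- The universal property of `R` as the polynomial ring in the `p_r(X_i)`: the `ℂ`-algebra
homomorphism that sends `p_r(X_i)` to `v (i, r)`. -/
def wreathLift : wreathRing ι →ₐ[ℂ] B :=
  AlgHom.ofLinearMap ((wreathMonomialBasis ι).constr ℂ fun s => (s.map v).prod)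
    (by
      rw [show (1 : wreathRing ι) = wreathMonomial 0 from rfl, ← wreathMonomialBasis_apply,
        Module.Basis.constr_basis]
      rfl)
    (by
      rw [LinearMap.map_mul_iff]
      refine (wreathMonomialBasis ι).ext fun s => (wreathMonomialBasis ι).ext fun t => ?_
      have hmul : wreathMonomialBasis ι s * wreathMonomialBasis ι t =
          wreathMonomialBasis ι (s + t) := by
        simp only [wreathMonomialBasis_apply, wreathMonomial, Multiset.map_add, Multiset.prod_add]
      simp only [LinearMap.compr₂_apply, LinearMap.compl₂_apply, LinearMap.comp_apply,
        LinearMap.mul_apply', hmul, Module.Basis.constr_basis, Multiset.map_add,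
        Multiset.prod_add])

theorem wreathLift_eq_sum (f : wreathRing ι) :
    wreathLift v f = ((wreathMonomialBasis ι).repr f).sum fun s a => a • (s.map v).prod :=
  (wreathMonomialBasis ι).constr_apply ℂ _ f

theorem wreathLift_inVars_p (n : ℕ+) (i : ι) : wreathLift v (inVars (p n) i) = v (i, n) := by
  have hsingle : inVars (p n) i = wreathMonomialBasis ι {(i, n)} := by
    simp only [wreathMonomialBasis_apply, wreathMonomial, Multiset.map_singleton,
      Multiset.prod_singleton]
  rw [hsingle]
  refine ((wreathMonomialBasis ι).constr_basis ℂ _ _).trans ?_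
  rw [Multiset.map_singleton, Multiset.prod_singleton]

end wreathLift

section kernelOf

variable {ι : Type} {τ : Type*} (g : ι → MvPowerSeries τ ℂ)

/-- `p_r(g_i)`, for a coloured part `(i, r)`. -/
def powerSumAt (x : ι × ℕ+) : MvPowerSeries τ ℂ :=
  MvPowerSeries.expand (x.2 : ℕ) x.2.ne_zero (g x.1)

/-- `p_r(X_i) p_r(g_i)`, for a coloured part `(i, r)`. -/
def kernelTerm (x : ι × ℕ+) : MvPowerSeries ((ι × ℕ) ⊕ τ) ℂ :=
  MvPowerSeries.rename (Function.Embedding.inl : ι × ℕ ↪ (ι × ℕ) ⊕ τ)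
      (inVars (p x.2) x.1 : MvPowerSeries (ι × ℕ) ℂ) *
    MvPowerSeries.rename (Function.Embedding.inr : τ ↪ (ι × ℕ) ⊕ τ) (powerSumAt g x)

theorem prod_map_kernelTerm (s : Multiset (ι × ℕ+)) :
    (s.map (kernelTerm g)).prod =
      MvPowerSeries.rename (Function.Embedding.inl : ι × ℕ ↪ (ι × ℕ) ⊕ τ)
          (wreathMonomial s : MvPowerSeries (ι × ℕ) ℂ) *
        MvPowerSeries.rename (Function.Embedding.inr : τ ↪ (ι × ℕ) ⊕ τ)
          (s.map (powerSumAt g)).prod := by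
  rw [wreathMonomial, ← Subalgebra.coe_val, map_multiset_prod, map_multiset_prod,
    map_multiset_prod, Multiset.map_map, Multiset.map_map, Multiset.map_map,
    ← Multiset.prod_map_mul]
  rfl

variable [Fintype ι]

/-- The series `(1/m) ∑_i X_i g_i`, where `m` is the number of colours. -/
def kernelOf : MvPowerSeries ((ι × ℕ) ⊕ τ) ℂ :=
  (1 / (Fintype.card ι : ℂ)) • ∑ i : ι,
    MvPowerSeries.rename (Function.Embedding.inl : ι × ℕ ↪ (ι × ℕ) ⊕ τ)
        (inVars (p 1) i : MvPowerSeries (ι × ℕ) ℂ) *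
      MvPowerSeries.rename (Function.Embedding.inr : τ ↪ (ι × ℕ) ⊕ τ) (g i)

theorem pleth_kernelOf_p (n : ℕ+) :
    pleth (kernelOf g) (p n) = (Fintype.card ι : ℂ)⁻¹ • ∑ i, kernelTerm g (i, n) := by
  rw [pleth_p, kernelOf, map_smul, map_sum, one_div]
  simp only [map_mul, expand_rename, coe_inVars_p, PNat.one_coe, expand_colourPowerSum, kernelTerm,
    powerSumAt]

theorem pleth_kernelOf_h [DecidableEq ι] (n : ℕ) :
    pleth (kernelOf g) (h n) =
      ∑ s ∈ ofWeight ι n, expTerm ℂ (Fintype.card ι) (kernelTerm g) s := by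
  induction n using Nat.strong_induction_on with
  | _ n ih =>
    obtain rfl | hn := n.eq_zero_or_pos
    · simp [h_zero, ofWeight_zero, expTerm, zWeighted]
    lift n to ℕ+ using hn
    refine nsmul_right_injective n.ne_zero ?_
    simp only [← map_nsmul, newton, map_sum, map_mul, nsmul_sum_expTerm]
    refine Finset.sum_congr rfl fun k _ => ?_
    rw [pleth_kernelOf_p, ih _ (Nat.sub_lt n.pos k.pos)]

theorem coeff_pleth_kernelOf_h [DecidableEq ι] (n : ℕ) (α : ι × ℕ →₀ ℕ) (β : τ →₀ ℕ) :
    MvPowerSeries.coeff (Finsupp.sumElim α β) (pleth (kernelOf g) (h n)) =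
      ∑ s ∈ ofWeight ι n, (zWeighted (fun x => Fintype.card ι * x.2) s : ℂ)⁻¹ *
        (MvPowerSeries.coeff α (wreathMonomial s : MvPowerSeries (ι × ℕ) ℂ) *
          MvPowerSeries.coeff β (s.map (powerSumAt g)).prod) := by
  rw [pleth_kernelOf_h, map_sum]
  refine Finset.sum_congr rfl fun s _ => ?_
  rw [expTerm, map_smul, smul_eq_mul, prod_map_kernelTerm, coeff_sumElim_rename_inl_mul_rename_inr]

theorem coeff_pleth_kernelOf_h_of_ne {n : ℕ} {α : ι × ℕ →₀ ℕ} (hn : n ≠ α.degree) (β : τ →₀ ℕ) :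
    MvPowerSeries.coeff (Finsupp.sumElim α β) (pleth (kernelOf g) (h n)) = 0 := by
  classical
  rw [coeff_pleth_kernelOf_h]
  refine Finset.sum_eq_zero fun s hs => ?_
  have hweight : α.degree ≠ weight s := fun hα => hn (by rw [hα, mem_ofWeight.1 hs])
  rw [coe_wreathMonomial, MvPowerSeries.IsHomogeneous.coeff_eq_zero
    (isHomogeneous_colourPowerProd _ s) hweight, zero_mul, mul_zero]

theorem coeff_plethExp_kernelOf (α : ι × ℕ →₀ ℕ) (β : τ →₀ ℕ) :
    MvPowerSeries.coeff (Finsupp.sumElim α β) (plethExp (kernelOf g)) =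
      MvPowerSeries.coeff (Finsupp.sumElim α β) (pleth (kernelOf g) (h α.degree)) := by
  let leftDegree (γ : (ι × ℕ) ⊕ τ →₀ ℕ) : ℕ :=
    (Finsupp.comapDomain Sum.inl γ Sum.inl_injective.injOn).degree
  have hvanish (γ : (ι × ℕ) ⊕ τ →₀ ℕ) (n : ℕ) (hn : n ≠ leftDegree γ) :
      MvPowerSeries.coeff γ (pleth (kernelOf g) (h n)) = 0 := by
    rw [← Finsupp.comapDomain_sumElim_comapDomain γ]
    exact coeff_pleth_kernelOf_h_of_ne g hn _
  rw [plethExp, coeff_tsum_of_ne leftDegree hvanish]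
  simp only [leftDegree, Finsupp.comapDomain_inl_sumElim]

end kernelOf

section reproducing

theorem finsum_sum_ofWeight {ι : Type*} [Finite ι] {M : Type*} [AddCommMonoid M]
    {T : Finset (Multiset (ι × ℕ+))} {F : Multiset (ι × ℕ+) → M} (hF : F.support ⊆ T) :
    ∑ᶠ d, ∑ s ∈ ofWeight ι d, F s = ∑ s ∈ T, F s := by
  classical
  have hfiber (d : ℕ) : ∑ s ∈ ofWeight ι d, F s = ∑ s ∈ T with weight s = d, F s := by
    refine (Finset.sum_subset (fun s hs => mem_ofWeight.2 (Finset.mem_filter.1 hs).2)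
      fun s hs hnot => ?_).symm
    by_contra hne
    exact hnot (Finset.mem_filter.2 ⟨hF hne, mem_ofWeight.1 hs⟩)
  simp only [hfiber]
  rw [← Finset.sum_fiberwise_of_maps_to fun s hs => Finset.mem_image_of_mem weight hs]
  refine finsum_eq_sum_of_support_subset _ fun d hd => ?_
  obtain ⟨s, hs, -⟩ := Finset.exists_ne_zero_of_sum_ne_zero hd
  obtain ⟨hsT, rfl⟩ := Finset.mem_filter.1 hs
  exact Finset.mem_coe.2 (Finset.mem_image_of_mem weight hsT)

variable {ι : Type} [Fintype ι]

theorem coeff_seriesPairing {F : MvPowerSeries ((ι × ℕ) ⊕ ℕ) ℂ} {β : ℕ →₀ ℕ}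
    {r : ℕ → wreathRing ι} (hr : ∀ d, MvPowerSeries.homogeneousComponent d (coeffY β F) = r d)
    (f : wreathRing ι) :
    MvPowerSeries.coeff β (seriesPairing F f) = ∑ᶠ d, wreathPairing (r d) f := by
  refine finsum_congr fun d => ?_
  rw [dif_pos (hr d ▸ (r d).2)]
  exact congrArg (fun a => wreathPairing a f) (Subtype.ext (hr d))

variable (g : ι → MvPowerSeries ℕ ℂ)

theorem homogeneousComponent_coeffY_plethExp_kernelOf [DecidableEq ι] (d : ℕ) (β : ℕ →₀ ℕ) :
    MvPowerSeries.homogeneousComponent d (coeffY β (plethExp (kernelOf g))) =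
      (∑ s ∈ ofWeight ι d, ((zWeighted (fun x => Fintype.card ι * x.2) s : ℂ)⁻¹ *
        MvPowerSeries.coeff β (s.map (powerSumAt g)).prod) • wreathMonomial s :
          wreathRing ι) := by
  ext α
  rw [MvPowerSeries.coeff_homogeneousComponent,
    show MvPowerSeries.coeff α (coeffY β (plethExp (kernelOf g))) = _ from
      coeff_plethExp_kernelOf g α β, ← Subalgebra.coe_val, map_sum, map_sum]
  trans MvPowerSeries.coeff (Finsupp.sumElim α β) (pleth (kernelOf g) (h d))
  · split_ifs with hd
    · rw [hd]
    · rw [coeff_pleth_kernelOf_h_of_ne g (Ne.symm hd)]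
  · rw [coeff_pleth_kernelOf_h]
    refine Finset.sum_congr rfl fun s _ => ?_
    rw [map_smul, map_smul, smul_eq_mul, Subalgebra.coe_val]
    ring

theorem coeff_wreathLift {τ : Type*} (v : ι × ℕ+ → MvPowerSeries τ ℂ) (β : τ →₀ ℕ)
    (f : wreathRing ι) :
    MvPowerSeries.coeff β (wreathLift v f) = ∑ s ∈ ((wreathMonomialBasis ι).repr f).support,
      (wreathMonomialBasis ι).repr f s * MvPowerSeries.coeff β (s.map v).prod := by
  simp only [wreathLift_eq_sum, Finsupp.sum, map_sum, map_smul, smul_eq_mul]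

theorem seriesPairing_plethExp_kernelOf (f : wreathRing ι) :
    seriesPairing (plethExp (kernelOf g)) f = wreathLift (powerSumAt g) f := by
  classical
  ext β
  rw [coeff_seriesPairing (homogeneousComponent_coeffY_plethExp_kernelOf g · β), coeff_wreathLift,
    ← finsum_sum_ofWeight]
  · refine finsum_congr fun d => ?_
    rw [map_sum, LinearMap.sum_apply]
    refine Finset.sum_congr rfl fun s _ => ?_
    have hz : (zWeighted (fun x => Fintype.card ι * x.2) s : ℂ) ≠ 0 :=
      Nat.cast_ne_zero.2 <| zWeighted_ne_zero fun x _ =>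
        mul_ne_zero (Fintype.card_pos_iff.2 ⟨x.1⟩).ne' x.2.ne_zero
    rw [map_smul, LinearMap.smul_apply, wreathPairing_wreathMonomial, smul_eq_mul]
    field_simp
  · exact fun s hs => Finset.mem_coe.2 (Finsupp.mem_support_iff.2 (left_ne_zero_of_mul hs))

end reproducing

section conjugation

theorem map_colourPowerSum {σ ι : Type*} (φ : ℂ →+* ℂ) (c : σ → ι) (i : ι) (n : ℕ) :
    MvPowerSeries.map φ (colourPowerSum c i n) = colourPowerSum c i n := by
  ext α
  rw [MvPowerSeries.coeff_map, coeff_colourPowerSum, apply_ite φ, map_one, map_zero]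

theorem map_colourPowerProd {σ ι : Type*} (φ : ℂ →+* ℂ) (c : σ → ι) (s : Multiset (ι × ℕ+)) :
    MvPowerSeries.map φ (colourPowerProd c s) = colourPowerProd c s := by
  rw [colourPowerProd, map_multiset_prod, Multiset.map_map]
  exact congrArg Multiset.prod (Multiset.map_congr rfl fun x _ => map_colourPowerSum φ c x.1 x.2)

theorem mvPowerSeries_map_smul {σ R S : Type*} [CommSemiring R] [CommSemiring S] (φ : R →+* S)
    (a : R) (f : MvPowerSeries σ R) :
    MvPowerSeries.map φ (a • f) = φ a • MvPowerSeries.map φ f := by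
  rw [MvPowerSeries.smul_eq_C_mul, map_mul, MvPowerSeries.map_C, MvPowerSeries.smul_eq_C_mul]

variable {ι : Type} [Fintype ι]

theorem coe_wreathConj (f : wreathRing ι) : (wreathConj f : MvPowerSeries (ι × ℕ) ℂ) =
    MvPowerSeries.map (starRingEnd ℂ) (f : MvPowerSeries (ι × ℕ) ℂ) := by
  conv_rhs => rw [← (wreathBasis ι).linearCombination_repr f, Finsupp.linearCombination_apply]
  simp only [wreathConj, Finsupp.sum, AddSubmonoidClass.coe_finsetSum, map_sum, SetLike.val_smul,
    mvPowerSeries_map_smul, wreathBasis_apply, coe_wreathP, map_colourPowerProd]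

/-- Complex conjugation of the coefficients in the `P_ρ`, as a ring homomorphism. -/
def wreathConjHom (ι : Type) [Fintype ι] : wreathRing ι →+* wreathRing ι where
  toFun := wreathConj
  map_one' := Subtype.ext <| by rw [coe_wreathConj, OneMemClass.coe_one, map_one]
  map_mul' f g := Subtype.ext <| by simp only [coe_wreathConj, MulMemClass.coe_mul, map_mul]
  map_zero' := Subtype.ext <| by rw [coe_wreathConj, ZeroMemClass.coe_zero, map_zero]
  map_add' f g := Subtype.ext <| by simp only [coe_wreathConj, AddMemClass.coe_add, map_add]

theorem wreathConjHom_smul (a : ℂ) (f : wreathRing ι) :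
    wreathConjHom ι (a • f) = starRingEnd ℂ a • wreathConjHom ι f :=
  Subtype.ext <| by
    rw [SetLike.val_smul]
    exact (coe_wreathConj _).trans <| (mvPowerSeries_map_smul _ a _).trans <|
      congrArg _ (coe_wreathConj f).symm

theorem wreathConjHom_inVars_p (n : ℕ+) (i : ι) :
    wreathConjHom ι (inVars (p n) i) = inVars (p n) i :=
  Subtype.ext <| (coe_wreathConj _).trans <| by rw [coe_inVars_p, map_colourPowerSum]

end conjugation

section rootsOfUnity

theorem prod_Icc_mod {M : Type*} [CommMonoid M] (m : ℕ) (F : ℕ → M) :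
    ∏ j ∈ Finset.Icc 1 m, F (j % m) = ∏ j ∈ Finset.range m, F j := by
  rw [← Nat.image_Ico_mod 1 m, Finset.prod_image (Nat.mod_injOn_Ico 1 m), add_comm 1 m,
    Finset.Ico_add_one_right_eq_Icc]

variable {m : ℕ} [NeZero m]

theorem card_Mu : Fintype.card (Mu m) = m := by
  rw [Fintype.card_eq_nat_card, Complex.card_rootsOfUnity]

theorem isPrimitiveRoot_zetaM : IsPrimitiveRoot (zetaM m) m := by
  rw [← IsPrimitiveRoot.coe_submonoidClass_iff, ← IsPrimitiveRoot.coe_units_iff]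
  exact Complex.isPrimitiveRoot_exp m (NeZero.ne m)

theorem zetaM_pow_mod (j : ℕ) : zetaM m ^ (j % m) = zetaM m ^ j := by
  simpa only [← isPrimitiveRoot_zetaM.eq_orderOf] using pow_mod_orderOf (zetaM m) j

theorem sum_muVal_zpow (k : ℤ) :
    ∑ ζ : Mu m, muVal ζ ^ k = if (m : ℤ) ∣ k then (m : ℂ) else 0 := by
  classical
  let χ : Mu m →* ℂ :=
    (Units.coeHom ℂ).comp ((rootsOfUnity m ℂ).subtype.comp (zpowGroupHom k))
  have hχ (ζ : Mu m) : χ ζ = muVal ζ ^ k := Units.val_zpow_eq_zpow_val _ k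
  have hχ_one : χ = 1 ↔ (m : ℤ) ∣ k := by
    refine ⟨fun h => (isPrimitiveRoot_zetaM.zpow_eq_one_iff_dvd k).1 <| Subtype.ext <|
      Units.ext <| DFunLike.congr_fun h (zetaM m), ?_⟩
    rintro ⟨l, rfl⟩
    ext ζ
    have hζ : ζ ^ m = 1 := Subtype.ext ζ.2
    change Units.coeHom ℂ (ζ ^ ((m : ℤ) * l) : Mu m) = 1
    rw [zpow_mul, zpow_natCast, hζ, one_zpow]
    rfl
  simp only [← hχ, sum_hom_units, hχ_one, card_Mu, Nat.cast_ite, Nat.cast_zero]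

theorem conj_muVal (ζ : Mu m) : starRingEnd ℂ (muVal ζ) = (muVal ζ)⁻¹ :=
  (Complex.conj_rootsOfUnity ζ.2).trans (Units.val_inv_eq_inv_val _)

theorem sum_conj_muVal_pow_smul_OmegaAt (j : ℕ) :
    (1 / (m : ℂ)) • ∑ ζ : Mu m, starRingEnd ℂ (muVal ζ ^ j) • OmegaAt (muVal ζ) =
      hProgression m (j % m) := by
  ext α
  have hterm (ζ : Mu m) : starRingEnd ℂ (muVal ζ ^ j) * muVal ζ ^ α.degree =
      muVal ζ ^ ((α.degree : ℤ) - j) := by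
    have hζ : muVal ζ ≠ 0 := Units.ne_zero _
    rw [map_pow, conj_muVal, inv_pow, zpow_sub₀ hζ, zpow_natCast, zpow_natCast, div_eq_inv_mul]
  simp only [map_smul, map_sum, smul_eq_mul, coeff_OmegaAt, hterm, sum_muVal_zpow,
    coeff_hProgression (Nat.mod_lt j (NeZero.pos m)), ← Nat.modEq_iff_dvd, mul_ite, mul_zero,
    one_div_mul_cancel (NeZero.ne (m : ℂ))]
  exact if_congr Nat.ModEq.comm rfl rfl

end rootsOfUnity

section wreathSchur

variable (m : ℕ) [NeZero m]

theorem kernelAlphabet_eq_kernelOf :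
    kernelAlphabet m = kernelOf fun ζ : Mu m => OmegaAt (muVal ζ) := by
  rw [kernelAlphabet, kernelOf, card_Mu]

theorem expand_inVars_p_one {ι : Type} (n : ℕ+) (i : ι) :
    MvPowerSeries.expand (n : ℕ) n.ne_zero (inVars (p 1) i : MvPowerSeries (ι × ℕ) ℂ) =
      inVars (p n) i := by
  rw [coe_inVars_p, coe_inVars_p, PNat.one_coe, expand_colourPowerSum]

/-- Plethystic substitution of `φ_j(𝔛)` with codomain restricted to `R`, so that it can be composed
with homomorphisms out of `R`. -/
def plethPhi (j : ℕ) : Lam →ₐ[ℂ] wreathRing (Mu m) :=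
  (pleth (phi m j)).codRestrict _ fun f => pleth_mem _ _ (expand_phi_mem m j) f

theorem plethPhi_p (j : ℕ) (n : ℕ+) : plethPhi m j (p n) =
    (1 / (m : ℂ)) • ∑ ζ : Mu m, muVal ζ ^ j • inVars (p n) ζ := by
  refine Subtype.ext ((pleth_p _ n).trans ?_)
  simp only [phi, map_smul, map_sum, SetLike.val_smul, AddSubmonoidClass.coe_finsetSum,
    expand_inVars_p_one]

theorem wreathLift_wreathConjHom_plethPhi_schur (j : ℕ) (lam : Par) :
    wreathLift (powerSumAt fun ζ : Mu m => OmegaAt (muVal ζ))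
        (wreathConjHom (Mu m) (plethPhi m j (schur lam))) =
      pleth (hProgression m (j % m)) (schur lam) := by
  let evalConj : Lam →+* MvPowerSeries ℕ ℂ :=
    ((wreathLift (powerSumAt fun ζ : Mu m => OmegaAt (muVal ζ))).toRingHom.comp
      (wreathConjHom (Mu m))).comp (plethPhi m j).toRingHom
  suffices hp : ∀ n, evalConj (p n) = pleth (hProgression m (j % m)) (p n) from
    ringHom_schur_eq (φ := evalConj) (ψ := (pleth (hProgression m (j % m))).toRingHom) hp lam
  intro n
  change wreathLift _ (wreathConjHom (Mu m) (plethPhi m j (p n))) = _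
  simp only [plethPhi_p, wreathConjHom_smul, map_sum, wreathConjHom_inVars_p, map_smul, map_div₀,
    map_one, map_natCast, wreathLift_inVars_p, powerSumAt, pleth_p,
    ← sum_conj_muVal_pow_smul_OmegaAt]

theorem wreathLift_wreathConj_wreathS (ρ : Mu m → Par) :
    wreathLift (powerSumAt fun ζ : Mu m => OmegaAt (muVal ζ)) (wreathConj (wreathS m ρ)) =
      ∏ j ∈ Finset.Icc 1 m, pleth (hProgression m (j % m)) (schur (ρ (zetaM m ^ j))) := by
  change wreathLift _ (wreathConjHom (Mu m)
    (∏ j ∈ Finset.Icc 1 m, plethPhi m j (schur (ρ (zetaM m ^ j))))) = _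
  simp only [map_prod, wreathLift_wreathConjHom_plethPhi_schur]

end wreathSchur

end

end WreathSym

theorem mainTheorem4 (m : ℕ) [NeZero m] (ρ : WreathSym.Mu m → WreathSym.Par) :
    WreathSym.G m ρ = ∏ j ∈ Finset.range m,
      WreathSym.pleth (WreathSym.hProgression m j)
        (WreathSym.schur (ρ (WreathSym.zetaM m ^ j))) := by
  rw [WreathSym.G, WreathSym.kernelAlphabet_eq_kernelOf, WreathSym.seriesPairing_plethExp_kernelOf,
    WreathSym.wreathLift_wreathConj_wreathS, ← WreathSym.prod_Icc_mod]
  simp only [WreathSym.zetaM_pow_mod]
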